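/- Let $K\ge K_a\ge 1$, $n\ge1$, $L\ge1$ be integers, $J>0$ with $M=2^J$ an integer, and $0\le\epsilon\le1$. There are $K$ single-antenna users, and a set $\mathcal K_a$ of exactly $K_a$ of them is active; the receiver has $L$ antennas. User $k$ has a codebook $x_{k,1},\dots,x_{k,M}\in\mathbb C^n$ with $\|x_{k,m}\|_2^2\le nP$. Each active user sends $x_{(k)}=x_{k,W_k}$, where the messages $W_k$ are independent and uniform on $\{1,\dots,M\}$; inactive users send $x_{(k)}=0$. Antenna $l$ observes $y_l=\sum_k h_{k,l}x_{(k)}+z_l$, where all $h_{k,l}$ and all entries of all $z_l\in\mathbb C^n$ are i.i.d. $\mathcal{CN}(0,1)$, independent of the messages. The decoder is a measurable function of $\mathbf Y=[y_1,\dots,y_L]$ and of the fading matrix $\mathbf H=(h_{k,l})$ (CSIR); it outputs a set of $K_a$ users declared active and a message $\hat W_k$ for each of them, with $\hat W_k=0$ for the other users. A code with power $P>0$ is admissible if its per-user probability of error satisfies $$P_e=\frac1{K_a}\sum_{k\in\mathcal K_a}\mathbb P[W_k\ne\hat W_k]\le\epsilon .$$ Let $E^*_b=\inf\{nP/J:\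 P>0 \text{ and an admissible code with power } P \text{ exists}\}\in[0,\infty]$ be the minimum energy-per-bit. The code may depend on $\mathcal K_a$, so the bounds below hold a fortiori for codes that have to work without knowledge of $\mathcal K_a$. Put $h_2(p)=-p\log_2p-(1-p)\log_2(1-p)$ with $0\log_2 0=0$. For an integer $t\ge1$ let $\mathbf H_t\in\mathbb C^{t\times L}$ have i.i.d. $\mathcal{CN}(0,1)$ entries. Consider the following conditions on $P>0$. (A) For all $t\in\{1,\dots,K_a\}$: $\displaystyle\Big(\frac t{K_a}-\epsilon\Big)J-h_2(\epsilon)\le\frac n{K_a}\,\mathbb E\big[\log_2|\mathbf I_L+P\mathbf H_t^H\mathbf H_t|\big].$ (B) For all $t\in\{1,\dots,K_a\}$: $\displaystyle\Big(\frac t{K_a}-\epsilon\Big)J-h_2(\epsilon)\le\frac n{K_a}\min\{L\log_2(1+Pt),\,t\log_2(1+PL)\}.$ (C) (Single-user meta-converse bound.) Let $h\in\mathbb C^L$ and $Z\in\mathbb C^{n+1}$ be independent with i.i.d. $\mathcal{CN}(0,1)$ entries, and let $G=P\|h\|_2^2$, $$S=\sum_{i=1}^{n+1}\Big(\ln(1+G)+1-\frac{|\sqrt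 G\,Z_i-1|^2}{1+G}\Big),\qquad T=\sum_{i=1}^{n+1}\Big(\ln(1+G)+1-|\sqrt G\,Z_i-\sqrt{1+G}|^2\Big).$$ Then $M\cdot\mathbb P[T\ge\gamma]\le1$ for every real $\gamma$ with $\mathbb P[S\le\gamma]=\epsilon$. Then: 1. If an admissible code with power $P>0$ exists, then $P$ satisfies (A), (B) and (C). 2. For every $P>0$ and $t\in\{1,\dots,K_a\}$ the expectation in (A) is finite and $\mathbb E[\log_2|\mathbf I_L+P\mathbf H_t^H\mathbf H_t|]\le\min\{L\log_2(1+Pt),\,t\log_2(1+PL)\}$; in particular (A) implies (B). 3. $E^*_b\ge\inf\frac{nP}J$, where the infimum (equal to $+\infty$ over the empty set) is over all $P>0$ satisfying (A); the same holds with (B), and with (A) and (C) together, in place of (A). -/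

import Mathlib

open MeasureTheory ProbabilityTheory
open scoped Matrix

noncomputable section

namespace MassiveAccess

/-- The circularly symmetric complex Gaussian law `CN(0,1)`: independent real and imaginary
parts, each centred Gaussian with variance `1/2`. -/
def complexGaussian : Measure ℂ :=
  ((gaussianReal 0 (1 / 2)).prod (gaussianReal 0 (1 / 2))).map (fun p => Complex.mk p.1 p.2)

/-- The law of a random vector in `ℂ^m` with i.i.d. `CN(0,1)` entries. -/
def gaussianVector (m : ℕ) : Measure (Fin m → ℂ) :=
  Measure.pi fun _ => complexGaussian

/-- The law of a random `m × k` matrix with i.i.d. `CN(0,1)` entries. -/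
def gaussianMatrix (m k : ℕ) : Measure (Fin m → Fin k → ℂ) :=
  Measure.pi fun _ : Fin m => Measure.pi fun _ : Fin k => complexGaussian

/-- Encoders and decoder for `K` potential users, `Ka` of which are active, with individual
codebooks of size `M` and blocklength `n`, maximal power `P`, `L` receive antennas and channel
state information at the receiver. The decoder maps the received matrix and the fading matrix to a
set of exactly `Ka` users declared active together with one message for each of them; the value
`none` at a user `k` means that `k` is declared inactive. -/
structure Code (K Ka M n L : ℕ) (P : ℝ) where
  /-- the codeword of each user for each message -/
  enc : Fin K → Fin M → EuclideanSpace ℂ (Fin n)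
  power_le : ∀ k m, ‖enc k m‖ ^ 2 ≤ n * P
  /-- the decoder, a function of the received signal and of the fading coefficients -/
  dec : (Fin n → Fin L → ℂ) × (Fin K → Fin L → ℂ) → Fin K → Option (Fin M)
  measurableSet_dec : ∀ u : Fin K → Option (Fin M), MeasurableSet (dec ⁻¹' {u})
  card_dec : ∀ yh, (Finset.univ.filter fun k => (dec yh k).isSome = true).card = Ka

variable {K Ka M n L : ℕ} {P : ℝ}

/-- The sent codeword of user `k` when `A` is the set of active users and `w` their messages;
inactive users send `0`. -/
def Code.sent (c : Code K Ka M n L P) (A : Finset (Fin K)) (w : A → Fin M) (k : Fin K) :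
    EuclideanSpace ℂ (Fin n) :=
  if hk : k ∈ A then c.enc k (w ⟨k, hk⟩) else 0

/-- The received matrix: antenna `l` observes `∑ k, h_{k,l} x_(k) + z_l`. -/
def Code.received (c : Code K Ka M n L P) (A : Finset (Fin K)) (w : A → Fin M)
    (H : Fin K → Fin L → ℂ) (Z : Fin n → Fin L → ℂ) : Fin n → Fin L → ℂ :=
  fun i l => (∑ k, H k l * c.sent A w k i) + Z i l

/-- The joint law of the messages of the active users (independent and uniform), the fading
matrix and the noise matrix (independent of each other and of the messages). -/
def channelLaw (K M n L : ℕ) (A : Finset (Fin K)) :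
    Measure ((A → Fin M) × (Fin K → Fin L → ℂ) × (Fin n → Fin L → ℂ)) :=
  (Measure.pi fun _ : A => uniformOn (Set.univ : Set (Fin M))).prod
    ((gaussianMatrix K L).prod (gaussianMatrix n L))

/-- The per-user probability of error when `A` is the set of active users. -/
def Code.pupe (c : Code K Ka M n L P) (A : Finset (Fin K)) : ℝ :=
  1 / (A.card : ℝ) * ∑ k : A,
    (channelLaw K M n L A).real
      {ω | c.dec (c.received A ω.1 ω.2.1 ω.2.2, ω.2.1) k ≠ some (ω.1 k)}

/-- The infimum of the energy-per-bit `n P / J` over all `P > 0` with property `C`, with value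
`⊤` if there is no such `P`. -/
def infEnergy (n : ℕ) (J : ℝ) (C : ℝ → Prop) : EReal :=
  sInf {e | ∃ P : ℝ, 0 < P ∧ C P ∧ e = ((n * P / J : ℝ) : EReal)}

/-- There is a code of power `P` whose per-user probability of error, for the active set `A`, is
at most `ε`. -/
def Achievable (M n L : ℕ) (ε : ℝ) (A : Finset (Fin K)) (P : ℝ) : Prop :=
  ∃ c : Code K A.card M n L P, c.pupe A ≤ ε

/-- The minimum energy-per-bit, where `J` is the number of information bits, `M = 2 ^ J`. -/
def minEnergyPerBit (M n L : ℕ) (J ε : ℝ) (A : Finset (Fin K)) : EReal :=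
  infEnergy n J (Achievable M n L ε A)

/-- The binary entropy function in bits. -/
def h₂ (p : ℝ) : ℝ := Real.binEntropy p / Real.log 2

/-- `log₂ |I_L + P Hᴴ H|` (the determinant is a positive real number). -/
def logDet {t L : ℕ} (P : ℝ) (H : Fin t → Fin L → ℂ) : ℝ :=
  Real.logb 2 (1 + (P : ℂ) • ((Matrix.of H)ᴴ * Matrix.of H)).det.re

/-- The Fano-type condition on `P`. -/
def FanoCondition (Ka n L : ℕ) (J ε P : ℝ) : Prop :=
  ∀ t ∈ Finset.Icc 1 Ka,
    ((t : ℝ) / Ka - ε) * J - h₂ ε ≤ (n : ℝ) / Ka * ∫ H, logDet P H ∂(gaussianMatrix t L)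

/-- The loosened condition on `P`. -/
def LooseCondition (Ka n L : ℕ) (J ε P : ℝ) : Prop :=
  ∀ t ∈ Finset.Icc 1 Ka,
    ((t : ℝ) / Ka - ε) * J - h₂ ε ≤
      (n : ℝ) / Ka * min (L * Real.logb 2 (1 + P * t)) (t * Real.logb 2 (1 + P * L))

/-- The law of the fading vector and of `N` noise symbols in the single-user channel. -/
def singleUserLaw (L N : ℕ) : Measure ((Fin L → ℂ) × (Fin N → ℂ)) :=
  (gaussianVector L).prod (gaussianVector N)

/-- The channel gain `P ‖h‖²` after coherent combining of the antennas. -/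
def gain {L : ℕ} (P : ℝ) (h : Fin L → ℂ) : ℝ := P * ∑ l, ‖h l‖ ^ 2

/-- The information density between the input with all symbols `√P` and the output, relative to
the output law `CN(0, I + P h hᴴ)` in each channel use, when the output follows the channel. -/
def densityTrue {L N : ℕ} (P : ℝ) (ω : (Fin L → ℂ) × (Fin N → ℂ)) : ℝ :=
  ∑ i, (Real.log (1 + gain P ω.1) + 1 -
    ‖(Real.sqrt (gain P ω.1) : ℂ) * ω.2 i - 1‖ ^ 2 / (1 + gain P ω.1))

/-- The same information density when the output follows the law `CN(0, I + P h hᴴ)` in each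
channel use, independently of the input. -/
def densityAux {L N : ℕ} (P : ℝ) (ω : (Fin L → ℂ) × (Fin N → ℂ)) : ℝ :=
  ∑ i, (Real.log (1 + gain P ω.1) + 1 -
    ‖(Real.sqrt (gain P ω.1) : ℂ) * ω.2 i - (Real.sqrt (1 + gain P ω.1) : ℂ)‖ ^ 2)

/-- The meta-converse bound `M ≤ 1 / ℙ[densityAux ≥ γ]` with `ℙ[densityTrue ≤ γ] = ε` for the
single-user channel with `L` receive antennas and receiver channel state information. The
blocklength is `n + 1` because the maximal power constraint at blocklength `n` is replaced by an
equal power constraint by means of one additional symbol. -/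
def MetaConverseCondition (M n L : ℕ) (ε P : ℝ) : Prop :=
  ∀ γ : ℝ, (singleUserLaw L (n + 1)).real {ω | densityTrue P ω ≤ γ} = ε →
    M * (singleUserLaw L (n + 1)).real {ω | γ ≤ densityAux P ω} ≤ 1

end MassiveAccess

end

/-!
Both converse bounds compare, for a *fixed* realisation of the fading, the law of the channel output
with an auxiliary law `Q` under which the output carries no information about the messages in
question: in each channel use `Q` is Gaussian with covariance `I + P Hᴴ H`. Writing
`I + P Hᴴ H = Cᴴ C` and `B = C⁻¹`, `Q` is the law of `Z C` for a standard Gaussian matrix `Z`, and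
the log-likelihood ratio (`infoDensity`) is explicit; `map_add_withDensity_infoDensity` is the change
of measure.

*Fano-type bound.* Let a set of `t` active users be given, with the messages of the others revealed
to the receiver and the codebooks centred. Let `f` be `a` times the number of these users decoded
correctly. Under `Q` the decisions are independent of the messages, so the mean of `exp f` is at
most `(1 + (exp a - 1) / M) ^ t`; the change of measure and `X ≤ exp X - 1` then bound the mean of
`f` under the channel by the mean information density plus `t log (1 + (exp a - 1) / M)`
(`fano_fixed_channel`). Independence and the power constraint bound the mean information density by
`n log |I + P Hᴴ H|`, because the trace of the whitened output covariance is at most `n L`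
(`sum_energy_superposition_le`, `trace_whitened`). After averaging over the fading, the choice
`exp a = M (1 - ε) / ε` gives the stated condition (`fano_of_tilted`). Applying `log x ≤ x - 1` to
the eigenvalues of either Gram matrix `Hᴴ H`, `H Hᴴ` gives the loosened condition
(`integral_log_det_le`).

*Meta-converse.* Some active user has error probability at most `ε`. Given everything else, this
user sees a single-user channel. Appending one symbol makes all codewords have energy `(n + 1) P`.
The information density then depends on the output only through the coherent combination of the
antennas, and by unitary invariance of the Gaussian law its law is that of `densityTrue` under the
channel and of `densityAux` under `Q`, whatever the codeword (`infoDensity_single_law`). The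
Neyman–Pearson lemma together with the fact that the correct decisions for the `M` messages are
disjoint events gives the bound with a strict inequality (`single_user_bound`), and `densityAux` has
no atoms (`singleUserLaw_densityAux_eq_zero`).
-/

namespace MassiveAccess

/-! ### Densities of Gaussian laws -/

/-- Tonelli's theorem for a product of functions of the separate coordinates. -/
lemma lintegral_pi_prod {m : ℕ} {X : Type*} [MeasurableSpace X] (μ : Measure X) [SigmaFinite μ]
    (f : Fin m → X → ENNReal) (hf : ∀ i, Measurable (f i)) :
    ∫⁻ x, ∏ i, f i (x i) ∂(Measure.pi fun _ : Fin m => μ) = ∏ i, ∫⁻ x, f i x ∂μ := by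
  induction m with
  | zero => simp
  | succ m ih =>
    have h := (measurePreserving_piFinSuccAbove (fun _ : Fin (m + 1) => μ) 0).symm
    rw [← h.lintegral_comp_emb (MeasurableEquiv.measurableEmbedding _), Fin.prod_univ_succ,
      ← ih (fun i => f i.succ) fun i => hf _]
    have hm : Measurable fun x : Fin m → X => ∏ i, f i.succ (x i) :=
      Finset.measurable_prod _ fun i _ => (hf _).comp (measurable_pi_apply i)
    rw [← lintegral_prod_mul (hf 0).aemeasurable hm.aemeasurable]
    refine lintegral_congr fun x => ?_
    simp [Fin.prod_univ_succ, MeasurableEquiv.piFinSuccAbove]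

/-- The product of measures with densities has the product of the densities as its density. -/
lemma pi_withDensity {m : ℕ} {X : Type*} [MeasurableSpace X] (μ : Measure X) [SigmaFinite μ]
    (f : Fin m → X → ENNReal) (hf : ∀ i, Measurable (f i))
    [∀ i, SigmaFinite (μ.withDensity (f i))] :
    Measure.pi (fun i => μ.withDensity (f i)) =
      (Measure.pi fun _ : Fin m => μ).withDensity (fun x => ∏ i, f i (x i)) := by
  refine Measure.pi_eq fun s hs => ?_
  rw [withDensity_apply _ (MeasurableSet.univ_pi hs),
    ← lintegral_indicator (MeasurableSet.univ_pi hs)]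
  have : ∀ x : Fin m → X, (Set.univ.pi s).indicator (fun x => ∏ i, f i (x i)) x =
      ∏ i, (s i).indicator (f i) (x i) := by
    intro x
    by_cases hx : x ∈ Set.univ.pi s
    · rw [Set.indicator_of_mem hx]
      exact Finset.prod_congr rfl fun i _ => (Set.indicator_of_mem (hx i trivial) _).symm
    · rw [Set.indicator_of_notMem hx]
      simp only [Set.mem_pi, Set.mem_univ, true_implies, not_forall] at hx
      obtain ⟨i, hi⟩ := hx
      exact (Finset.prod_eq_zero (Finset.mem_univ i) (Set.indicator_of_notMem hi _)).symm
  simp_rw [this]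
  rw [lintegral_pi_prod μ _ fun i => (hf i).indicator (hs i)]
  exact Finset.prod_congr rfl fun i _ => by
    rw [withDensity_apply _ (hs i), lintegral_indicator (hs i)]

instance : IsProbabilityMeasure complexGaussian :=
  Measure.isProbabilityMeasure_map (by
    exact (Complex.measurableEquivRealProd.symm.measurable).aemeasurable)

instance (m : ℕ) : IsProbabilityMeasure (gaussianVector m) := by
  unfold gaussianVector; infer_instance

instance (m k : ℕ) : IsProbabilityMeasure (gaussianMatrix m k) := by
  unfold gaussianMatrix; infer_instance

lemma complexGaussian_eq_withDensity : complexGaussian =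
    volume.withDensity fun z => ENNReal.ofReal (Real.pi⁻¹ * Real.exp (-‖z‖ ^ 2)) := by
  have hv : (1 / 2 : NNReal) ≠ 0 := by norm_num
  unfold complexGaussian
  rw [gaussianReal_of_var_ne_zero 0 hv, prod_withDensity (measurable_gaussianPDF _ _)
    (measurable_gaussianPDF _ _)]
  have hvp := Complex.volume_preserving_equiv_real_prod.symm
  ext s hs
  have hmk : (fun p : ℝ × ℝ => Complex.mk p.1 p.2) = Complex.measurableEquivRealProd.symm := rfl
  rw [hmk, MeasurableEquiv.map_apply,
    withDensity_apply _ (Complex.measurableEquivRealProd.symm.measurable hs),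
    withDensity_apply _ hs, ← hvp.setLIntegral_comp_preimage_emb
      (MeasurableEquiv.measurableEmbedding _)]
  refine lintegral_congr fun p => ?_
  rw [gaussianPDF, gaussianPDF, ← ENNReal.ofReal_mul (gaussianPDFReal_nonneg _ _ _)]
  congr 1
  have hn : ‖Complex.measurableEquivRealProd.symm p‖ ^ 2 = p.1 ^ 2 + p.2 ^ 2 := by
    rw [← Complex.normSq_eq_norm_sq, Complex.measurableEquivRealProd_symm_apply]
    simp [Complex.normSq_apply, sq]
  have h2 : (2 * Real.pi * ((1 / 2 : NNReal) : ℝ)) = Real.pi := by push_cast; ring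
  rw [gaussianPDFReal, gaussianPDFReal, hn, h2, mul_mul_mul_comm, ← Real.exp_add, ← mul_inv,
    Real.mul_self_sqrt Real.pi_pos.le]
  congr 2
  push_cast
  ring

lemma gaussianVector_eq_withDensity (m : ℕ) : gaussianVector m =
    volume.withDensity fun z : Fin m → ℂ =>
      ENNReal.ofReal (Real.pi⁻¹ ^ m * Real.exp (-∑ i, ‖z i‖ ^ 2)) := by
  have hmeas : Measurable fun z : ℂ => ENNReal.ofReal (Real.pi⁻¹ * Real.exp (-‖z‖ ^ 2)) := by
    fun_prop
  have hsf : SigmaFinite (volume.withDensity fun z : ℂ =>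
      ENNReal.ofReal (Real.pi⁻¹ * Real.exp (-‖z‖ ^ 2))) := by
    rw [← complexGaussian_eq_withDensity]; infer_instance
  unfold gaussianVector
  rw [complexGaussian_eq_withDensity, pi_withDensity _ _ fun _ => hmeas]
  congr 1
  funext z
  rw [← ENNReal.ofReal_prod_of_nonneg fun i _ => by positivity, Finset.prod_mul_distrib,
    ← Real.exp_sum]
  simp

lemma ofReal_sum_norm_sq {ι : Type*} [Fintype ι] (v : ι → ℂ) :
    ((∑ i, ‖v i‖ ^ 2 : ℝ) : ℂ) = v ⬝ᵥ star v := by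
  simp [dotProduct, Complex.mul_conj, Complex.normSq_eq_norm_sq]

lemma measurable_vecMul {m k : ℕ} (D : Matrix (Fin m) (Fin k) ℂ) :
    Measurable fun z : Fin m → ℂ => z ᵥ* D := by
  have : Continuous fun z : Fin m → ℂ => z ᵥ* D := by fun_prop
  exact this.measurable

lemma unitary_norm_sq {m : ℕ} (U : Matrix (Fin m) (Fin m) ℂ) (hU : U * Uᴴ = 1) (y : Fin m → ℂ) :
    ∑ i, ‖(y ᵥ* U) i‖ ^ 2 = ∑ i, ‖y i‖ ^ 2 := by
  have : ((∑ i, ‖(y ᵥ* U) i‖ ^ 2 : ℝ) : ℂ) = ((∑ i, ‖y i‖ ^ 2 : ℝ) : ℂ) := by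
    rw [ofReal_sum_norm_sq, ofReal_sum_norm_sq, Matrix.star_vecMul,
      Matrix.dotProduct_mulVec, Matrix.vecMul_vecMul, hU, Matrix.vecMul_one]
  exact_mod_cast this

lemma gaussianVector_map_apply {m : ℕ} (i : Fin m) :
    (gaussianVector m).map (fun z => z i) = complexGaussian := by
  unfold gaussianVector
  change Measure.map (Function.eval i) _ = _
  rw [Measure.pi_map_eval]
  simp

lemma gaussianMatrix_map_row {n L : ℕ} (i : Fin n) :
    (gaussianMatrix n L).map (fun Z => Z i) = gaussianVector L := by
  unfold gaussianMatrix
  change Measure.map (Function.eval i) _ = _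
  rw [Measure.pi_map_eval]
  simp [gaussianVector]

/-- The complex linear map `z ↦ z ᵥ* C` has real determinant `|det C|²`, so it scales volume by
`|det B|²`, where `B = C⁻¹`. -/
lemma map_vecMul_volume {m : ℕ} (C B : Matrix (Fin m) (Fin m) ℂ) (hCB : C * B = 1) :
    (volume : Measure (Fin m → ℂ)).map (fun z => z ᵥ* C) =
      ENNReal.ofReal (‖B.det‖ ^ 2) • volume := by
  have hdet : C.det * B.det = 1 := by rw [← Matrix.det_mul, hCB, Matrix.det_one]
  let f : (Fin m → ℂ) →ₗ[ℝ] (Fin m → ℂ) := (Matrix.toLin' Cᵀ).restrictScalars ℝ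
  have hf : LinearMap.det f = ‖C.det‖ ^ 2 := by
    simp only [f]
    rw [LinearMap.det_restrictScalars, LinearMap.det_toLin', Matrix.det_transpose,
      Algebra.norm_complex_apply, Complex.normSq_eq_norm_sq]
  have hC : ‖C.det‖ * ‖B.det‖ = 1 := by rw [← norm_mul, hdet, norm_one]
  have hC0 : ‖C.det‖ ≠ 0 := left_ne_zero_of_mul_eq_one hC
  have hff : (f : (Fin m → ℂ) → Fin m → ℂ) = fun z => z ᵥ* C := by
    funext z
    simp [f, Matrix.mulVec_transpose]
  rw [← hff, Measure.map_linearMap_addHaar_eq_smul_addHaar _ (by rw [hf]; positivity), hf]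
  congr 2
  rw [abs_of_nonneg (by positivity), ← inv_pow, inv_eq_of_mul_eq_one_right hC]

/-- If `C` is invertible with inverse `B`, the law of `z ᵥ* C` is Gaussian with covariance `Cᴴ C`;
this is its density relative to the standard law. -/
lemma gaussianVector_map_vecMul {m : ℕ} (C B : Matrix (Fin m) (Fin m) ℂ) (hCB : C * B = 1) :
    (gaussianVector m).map (fun z => z ᵥ* C) = (gaussianVector m).withDensity fun y =>
      ENNReal.ofReal (‖B.det‖ ^ 2 * Real.exp (∑ i, ‖y i‖ ^ 2 - ∑ i, ‖(y ᵥ* B) i‖ ^ 2)) := by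
  have hg : Measurable fun z : Fin m → ℂ =>
      ENNReal.ofReal (Real.pi⁻¹ ^ m * Real.exp (-∑ i, ‖z i‖ ^ 2)) := by fun_prop
  have hB := measurable_vecMul B
  have hgB : Measurable fun y : Fin m → ℂ =>
      ENNReal.ofReal (Real.pi⁻¹ ^ m * Real.exp (-∑ i, ‖(y ᵥ* B) i‖ ^ 2)) := hg.comp hB
  have hw : Measurable fun y : Fin m → ℂ => ENNReal.ofReal (‖B.det‖ ^ 2 *
      Real.exp (∑ i, ‖y i‖ ^ 2 - ∑ i, ‖(y ᵥ* B) i‖ ^ 2)) := by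
    have : ∀ i, Measurable fun y : Fin m → ℂ => (y ᵥ* B) i := fun i =>
      (measurable_pi_apply i).comp hB
    fun_prop
  ext s hs
  rw [Measure.map_apply (measurable_vecMul C) hs, gaussianVector_eq_withDensity,
    withDensity_apply _ (measurable_vecMul C hs), withDensity_apply _ hs]
  rw [setLIntegral_withDensity_eq_setLIntegral_mul _ hg hw hs]
  have h1 : ∀ z : Fin m → ℂ, z ᵥ* C ᵥ* B = z := by
    intro z; rw [Matrix.vecMul_vecMul, hCB, Matrix.vecMul_one]
  have h2 : ∫⁻ z in (fun z => z ᵥ* C) ⁻¹' s,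
      ENNReal.ofReal (Real.pi⁻¹ ^ m * Real.exp (-∑ i, ‖z i‖ ^ 2)) =
      ∫⁻ y in s, ENNReal.ofReal (Real.pi⁻¹ ^ m * Real.exp (-∑ i, ‖(y ᵥ* B) i‖ ^ 2))
        ∂((volume : Measure (Fin m → ℂ)).map (fun z => z ᵥ* C)) := by
    rw [setLIntegral_map hs hgB (measurable_vecMul C)]
    simp_rw [h1]
  rw [h2, map_vecMul_volume C B hCB, Measure.restrict_smul, lintegral_smul_measure,
    smul_eq_mul, ← lintegral_const_mul _ hgB]
  refine lintegral_congr fun y => ?_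
  simp only [Pi.mul_apply]
  rw [← ENNReal.ofReal_mul (by positivity), ← ENNReal.ofReal_mul (by positivity)]
  congr 1
  rw [mul_mul_mul_comm, ← Real.exp_add, ← mul_assoc, mul_comm (‖B.det‖ ^ 2)]
  congr 2
  ring

/-- Density of the shifted standard law relative to the standard law. -/
lemma gaussianVector_map_add {m : ℕ} (u : Fin m → ℂ) :
    (gaussianVector m).map (fun z => u + z) = (gaussianVector m).withDensity fun y =>
      ENNReal.ofReal (Real.exp (∑ i, ‖y i‖ ^ 2 - ∑ i, ‖(y - u) i‖ ^ 2)) := by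
  have hg : Measurable fun z : Fin m → ℂ =>
      ENNReal.ofReal (Real.pi⁻¹ ^ m * Real.exp (-∑ i, ‖z i‖ ^ 2)) := by fun_prop
  have hw : Measurable fun y : Fin m → ℂ =>
      ENNReal.ofReal (Real.exp (∑ i, ‖y i‖ ^ 2 - ∑ i, ‖(y - u) i‖ ^ 2)) := by
    simp only [Pi.sub_apply]
    fun_prop
  have hu : Measurable fun z : Fin m → ℂ => u + z := measurable_const_add u
  ext s hs
  rw [Measure.map_apply hu hs, gaussianVector_eq_withDensity, withDensity_apply _ (hu hs),
    withDensity_apply _ hs, setLIntegral_withDensity_eq_setLIntegral_mul _ hg hw hs,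
    ← (measurePreserving_add_left (volume : Measure (Fin m → ℂ)) u).setLIntegral_comp_preimage hs
      (hg.mul hw)]
  refine lintegral_congr fun z => ?_
  simp only [Pi.mul_apply]
  rw [← ENNReal.ofReal_mul (by positivity), mul_assoc, ← Real.exp_add, add_sub_cancel_left u z]
  congr 3
  ring

/-- The standard Gaussian law is invariant under unitary maps. -/
lemma gaussianVector_map_unitary {m : ℕ} (U : Matrix (Fin m) (Fin m) ℂ) (hU : U * Uᴴ = 1) :
    (gaussianVector m).map (fun z => z ᵥ* U) = gaussianVector m := by
  rw [gaussianVector_map_vecMul U Uᴴ hU]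
  have h1 : ‖(Uᴴ).det‖ = 1 := by
    have h := congrArg (fun A => ‖Matrix.det A‖) hU
    simp only [Matrix.det_mul, norm_mul, Matrix.det_one, norm_one, Matrix.det_conjTranspose,
      norm_star] at h ⊢
    nlinarith [norm_nonneg U.det]
  have h2 : Uᴴ * Uᴴᴴ = 1 := by
    rw [Matrix.conjTranspose_conjTranspose]; exact mul_eq_one_comm.mp hU
  simp_rw [h1, unitary_norm_sq Uᴴ h2]
  simp

/-! ### Gaussian matrices, unitary invariance and second moments -/

lemma gaussianMatrix_map_add {m k : ℕ} (u : Fin m → Fin k → ℂ) :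
    (gaussianMatrix m k).map (fun Z => u + Z) = (gaussianMatrix m k).withDensity fun Y =>
      ENNReal.ofReal (Real.exp (∑ i, ∑ l, ‖Y i l‖ ^ 2 - ∑ i, ∑ l, ‖Y i l - u i l‖ ^ 2)) := by
  have hmeas : ∀ i, Measurable fun y : Fin k → ℂ => ENNReal.ofReal
      (Real.exp (∑ l, ‖y l‖ ^ 2 - ∑ l, ‖(y - u i) l‖ ^ 2)) := by
    intro i
    simp only [Pi.sub_apply]
    fun_prop
  have hs : ∀ i, SigmaFinite ((gaussianVector k).withDensity fun y : Fin k → ℂ => ENNReal.ofReal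
      (Real.exp (∑ l, ‖y l‖ ^ 2 - ∑ l, ‖(y - u i) l‖ ^ 2))) := by
    intro i
    have hf : IsProbabilityMeasure ((gaussianVector k).map fun z => u i + z) :=
      Measure.isProbabilityMeasure_map (measurable_const_add _).aemeasurable
    rw [← gaussianVector_map_add]; infer_instance
  have hs' : ∀ i, SigmaFinite ((gaussianVector k).map fun z => u i + z) := fun i => by
    rw [gaussianVector_map_add]; exact hs i
  have h := Measure.pi_map_pi (μ := fun _ : Fin m => gaussianVector k) (f := fun i z => u i + z)
    fun i => (measurable_const_add (u i)).aemeasurable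
  have h' : (gaussianMatrix m k).map (fun Z => u + Z) =
      Measure.pi fun i => (gaussianVector k).map fun z => u i + z := h
  rw [h']
  simp_rw [gaussianVector_map_add]
  rw [pi_withDensity _ _ hmeas]
  change (gaussianMatrix m k).withDensity _ = _
  congr 1
  funext Y
  rw [← ENNReal.ofReal_prod_of_nonneg fun i _ => by positivity, ← Real.exp_sum,
    Finset.sum_sub_distrib]
  rfl

lemma gaussianMatrix_map_vecMul {m k : ℕ} (C B : Matrix (Fin k) (Fin k) ℂ) (hCB : C * B = 1) :
    (gaussianMatrix m k).map (fun Z i => Z i ᵥ* C) = (gaussianMatrix m k).withDensity fun Y =>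
      ENNReal.ofReal ((‖B.det‖ ^ 2) ^ m *
        Real.exp (∑ i, ∑ l, ‖Y i l‖ ^ 2 - ∑ i, ∑ l, ‖(Y i ᵥ* B) l‖ ^ 2)) := by
  have hmeas : Measurable fun y : Fin k → ℂ => ENNReal.ofReal
      (‖B.det‖ ^ 2 * Real.exp (∑ l, ‖y l‖ ^ 2 - ∑ l, ‖(y ᵥ* B) l‖ ^ 2)) := by
    have : ∀ l, Measurable fun y : Fin k → ℂ => (y ᵥ* B) l := fun l =>
      (measurable_pi_apply l).comp (measurable_vecMul B)
    fun_prop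
  have hf : IsProbabilityMeasure ((gaussianVector k).map fun z => z ᵥ* C) :=
    Measure.isProbabilityMeasure_map (measurable_vecMul C).aemeasurable
  have hs : SigmaFinite ((gaussianVector k).withDensity fun y : Fin k → ℂ => ENNReal.ofReal
      (‖B.det‖ ^ 2 * Real.exp (∑ l, ‖y l‖ ^ 2 - ∑ l, ‖(y ᵥ* B) l‖ ^ 2))) := by
    rw [← gaussianVector_map_vecMul C B hCB]; infer_instance
  have h' : (gaussianMatrix m k).map (fun Z i => Z i ᵥ* C) =
      Measure.pi fun _ => (gaussianVector k).map fun z => z ᵥ* C :=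
    Measure.pi_map_pi (μ := fun _ : Fin m => gaussianVector k) (f := fun i z => z ᵥ* C)
      fun i => (measurable_vecMul C).aemeasurable
  rw [h', gaussianVector_map_vecMul C B hCB, pi_withDensity _ _ fun _ => hmeas]
  change (gaussianMatrix m k).withDensity _ = _
  congr 1
  funext Y
  rw [← ENNReal.ofReal_prod_of_nonneg fun i _ => by positivity, Finset.prod_mul_distrib,
    ← Real.exp_sum, Finset.sum_sub_distrib]
  simp

/-- The coordinates selected by an injective map form again an i.i.d. family. -/
lemma pi_map_comp_injective {ι κ X : Type*} [Fintype ι] [Fintype κ] [MeasurableSpace X]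
    (μ : Measure X) [IsProbabilityMeasure μ] {e : κ → ι} (he : Function.Injective e) :
    (Measure.pi fun _ : ι => μ).map (fun x k => x (e k)) = Measure.pi fun _ : κ => μ := by
  have h := iIndepFun_pi (μ := fun _ : ι => μ) (X := fun _ x => x) fun _ => aemeasurable_id
  have h2 := (iIndepFun_iff_map_fun_eq_pi_map (fun k =>
    (measurable_pi_apply (e k)).aemeasurable)).mp (h.precomp he)
  rw [h2]
  congr 1
  funext k
  change Measure.map (Function.eval (e k)) (Measure.pi fun _ : ι => μ) = μ
  classical
  rw [Measure.pi_map_eval]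
  simp

lemma gaussianMatrix_map_comp {m k L : ℕ} {e : Fin m → Fin k} (he : Function.Injective e) :
    (gaussianMatrix k L).map (fun H i => H (e i)) = gaussianMatrix m L :=
  pi_map_comp_injective (gaussianVector L) he

/-- Every vector can be rotated by a unitary matrix onto a coordinate axis. -/
lemma exists_unitary_vecMul_eq_single {m : ℕ} (i₀ : Fin m) (x : Fin m → ℂ) :
    ∃ U : Matrix (Fin m) (Fin m) ℂ, U * Uᴴ = 1 ∧
      x ᵥ* U = Pi.single i₀ ((Real.sqrt (∑ i, ‖x i‖ ^ 2) : ℝ) : ℂ) := by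
  set X : EuclideanSpace ℂ (Fin m) := WithLp.toLp 2 x with hX
  have hXn : ‖X‖ = Real.sqrt (∑ i, ‖x i‖ ^ 2) := by rw [EuclideanSpace.norm_eq]
  rw [← hXn]
  by_cases h0 : X = 0
  · refine ⟨1, by simp, ?_⟩
    have : x = 0 := by
      have := congrArg WithLp.ofLp h0
      simpa [hX] using this
    rw [h0, this]
    simp
  · have hn : ‖X‖ ≠ 0 := norm_ne_zero_iff.mpr h0
    have ho : Orthonormal ℂ (({i₀} : Set (Fin m)).domRestrict
        fun _ => ((‖X‖⁻¹ : ℝ) : ℂ) • X) := by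
      rw [orthonormal_iff_ite]
      rintro ⟨i, hi⟩ ⟨j, hj⟩
      obtain rfl : i = i₀ := hi
      obtain rfl : j = i := hj
      have : ‖((‖X‖⁻¹ : ℝ) : ℂ) • X‖ = 1 := by
        rw [norm_smul, Complex.norm_real, norm_inv, norm_norm, inv_mul_cancel₀ hn]
      simp only [Set.domRestrict_apply, inner_self_eq_norm_sq_to_K, if_true]
      rw [this]
      simp
    obtain ⟨b, hb⟩ := ho.exists_orthonormalBasis_extension_of_card_eq (by simp)
    have hb0 : X = (‖X‖ : ℂ) • b i₀ := by
      rw [hb i₀ rfl, smul_smul]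
      have : (‖X‖ : ℂ) ≠ 0 := by exact_mod_cast hn
      simp [this]
    refine ⟨Matrix.of fun l j => star (b j l), mul_eq_one_comm.mp ?_, ?_⟩
    · ext j k
      have := orthonormal_iff_ite.mp b.orthonormal k j
      rw [PiLp.inner_apply] at this
      simp only [Matrix.mul_apply, Matrix.conjTranspose_apply, Matrix.of_apply, star_star,
        Matrix.one_apply]
      simp only [RCLike.inner_apply] at this
      simpa [eq_comm] using this
    · funext j
      have hb' := orthonormal_iff_ite.mp b.orthonormal j i₀
      rw [PiLp.inner_apply] at hb'
      simp only [RCLike.inner_apply] at hb'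
      have hx : ∀ l, x l = (‖X‖ : ℂ) * b i₀ l := fun l => by
        have := congrArg (fun v : EuclideanSpace ℂ (Fin m) => v l) hb0
        simpa [hX] using this
      simp only [Matrix.vecMul, dotProduct, Matrix.of_apply]
      simp_rw [hx, mul_assoc, ← Finset.mul_sum]
      simp only [RCLike.star_def]
      rw [hb', Pi.single_apply]
      simp [eq_comm]

/-- Two vectors of the same length are related by a unitary matrix. -/
lemma exists_unitary_vecMul_eq {m : ℕ} (x y : Fin m → ℂ)
    (h : ∑ i, ‖x i‖ ^ 2 = ∑ i, ‖y i‖ ^ 2) :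
    ∃ U : Matrix (Fin m) (Fin m) ℂ, U * Uᴴ = 1 ∧ x ᵥ* U = y := by
  cases m with
  | zero => exact ⟨1, by simp, Subsingleton.elim _ _⟩
  | succ m =>
    obtain ⟨U, hU, hx⟩ := exists_unitary_vecMul_eq_single 0 x
    obtain ⟨V, hV, hy⟩ := exists_unitary_vecMul_eq_single 0 y
    refine ⟨U * Vᴴ, ?_, ?_⟩
    · rw [Matrix.conjTranspose_mul, Matrix.conjTranspose_conjTranspose, Matrix.mul_assoc,
        ← Matrix.mul_assoc Vᴴ, mul_eq_one_comm.mp hV, Matrix.one_mul, hU]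
    · rw [← Matrix.vecMul_vecMul, hx, h, ← hy, Matrix.vecMul_vecMul, hV, Matrix.vecMul_one]

/-- A linear combination of independent standard Gaussians is a multiple of one of them. -/
lemma gaussianVector_map_dotProduct {m : ℕ} (a : Fin m → ℂ) :
    (gaussianVector m).map (fun z => ∑ l, z l * a l) =
      complexGaussian.map (fun z => ((Real.sqrt (∑ l, ‖a l‖ ^ 2) : ℝ) : ℂ) * z) := by
  cases m with
  | zero => simp [Measure.map_const]
  | succ m =>
    obtain ⟨U, hU, ha⟩ := exists_unitary_vecMul_eq_single 0 (star a)
    simp only [Pi.star_apply, norm_star] at ha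
    have h1 : ∀ z : Fin (m + 1) → ℂ, ∑ l, z l * a l =
        ((Real.sqrt (∑ l, ‖a l‖ ^ 2) : ℝ) : ℂ) * (z ᵥ* U) 0 := by
      intro z
      have h2 : z ⬝ᵥ a = (z ᵥ* U) ⬝ᵥ star (star a ᵥ* U) := by
        rw [Matrix.star_vecMul, star_star, Matrix.dotProduct_mulVec, Matrix.vecMul_vecMul, hU,
          Matrix.vecMul_one]
      rw [ha] at h2
      change z ⬝ᵥ a = _
      rw [h2]
      rw [dotProduct, Fintype.sum_eq_single 0 fun j hj => by simp [Pi.single_eq_of_ne hj]]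
      simp [mul_comm]
    simp_rw [h1]
    have h3 : complexGaussian = (gaussianVector (m + 1)).map (fun z => (z ᵥ* U) 0) := by
      have h5 : (fun z : Fin (m + 1) → ℂ => (z ᵥ* U) 0) =
        (fun z => z 0) ∘ fun z => z ᵥ* U := rfl
      rw [h5, ← Measure.map_map (measurable_pi_apply 0) (measurable_vecMul U),
        gaussianVector_map_unitary U hU, gaussianVector_map_apply]
    have h6 : Measurable fun z : Fin (m + 1) → ℂ => (z ᵥ* U) 0 :=
      (measurable_pi_apply 0).comp (measurable_vecMul U)
    rw [h3, Measure.map_map (measurable_const_mul _) h6]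
    rfl

/-- Row-wise version of `gaussianVector_map_dotProduct`. -/
lemma gaussianMatrix_map_dotProduct {m k : ℕ} (a : Fin k → ℂ) :
    (gaussianMatrix m k).map (fun Z i => ∑ l, Z i l * a l) =
      (gaussianVector m).map (fun z i => ((Real.sqrt (∑ l, ‖a l‖ ^ 2) : ℝ) : ℂ) * z i) := by
  have hm1 : Measurable fun z : Fin k → ℂ => ∑ l, z l * a l := by fun_prop
  have hm2 : Measurable fun z : ℂ => ((Real.sqrt (∑ l, ‖a l‖ ^ 2) : ℝ) : ℂ) * z := by fun_prop
  have p1 : IsProbabilityMeasure ((gaussianVector k).map fun z => ∑ l, z l * a l) :=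
    Measure.isProbabilityMeasure_map hm1.aemeasurable
  have p2 : IsProbabilityMeasure (complexGaussian.map fun z =>
      ((Real.sqrt (∑ l, ‖a l‖ ^ 2) : ℝ) : ℂ) * z) :=
    Measure.isProbabilityMeasure_map hm2.aemeasurable
  have h1 := Measure.pi_map_pi (μ := fun _ : Fin m => gaussianVector k)
    (f := fun _ z => ∑ l, z l * a l) fun i => hm1.aemeasurable
  have h2 := Measure.pi_map_pi (μ := fun _ : Fin m => complexGaussian)
    (f := fun _ z => ((Real.sqrt (∑ l, ‖a l‖ ^ 2) : ℝ) : ℂ) * z) fun i => hm2.aemeasurable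
  simp_rw [gaussianVector_map_dotProduct] at h1
  exact h1.trans h2.symm

lemma map_re_complexGaussian : complexGaussian.map Complex.re = gaussianReal 0 (1 / 2) := by
  unfold complexGaussian
  have hm : Measurable fun p : ℝ × ℝ => Complex.mk p.1 p.2 :=
    Complex.measurableEquivRealProd.symm.measurable
  rw [Measure.map_map Complex.measurable_re hm]
  have : Complex.re ∘ (fun p : ℝ × ℝ => Complex.mk p.1 p.2) = Prod.fst := rfl
  rw [this, Measure.map_fst_prod]
  simp

lemma map_im_complexGaussian : complexGaussian.map Complex.im = gaussianReal 0 (1 / 2) := by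
  unfold complexGaussian
  have hm : Measurable fun p : ℝ × ℝ => Complex.mk p.1 p.2 :=
    Complex.measurableEquivRealProd.symm.measurable
  rw [Measure.map_map Complex.measurable_im hm]
  have : Complex.im ∘ (fun p : ℝ × ℝ => Complex.mk p.1 p.2) = Prod.snd := rfl
  rw [this, Measure.map_snd_prod]
  simp

lemma integral_sq_gaussianReal_half : ∫ x : ℝ, x ^ 2 ∂(gaussianReal 0 (1 / 2)) = 1 / 2 := by
  have h := variance_id_gaussianReal (μ := 0) (v := 1 / 2)
  rw [variance_of_integral_eq_zero aemeasurable_id (by simp)] at h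
  simpa using h

lemma integrable_gaussianReal_half :
    Integrable (fun x : ℝ => x) (gaussianReal 0 (1 / 2)) ∧
      Integrable (fun x : ℝ => x ^ 2) (gaussianReal 0 (1 / 2)) := by
  constructor
  · exact (memLp_id_gaussianReal (μ := 0) (v := 1 / 2) 1).integrable le_rfl
  · exact (memLp_id_gaussianReal (μ := 0) (v := 1 / 2) 2).integrable_sq

/-- Second moment of an affine function of a standard complex Gaussian. -/
lemma complexGaussian_second_moment (c : ℂ) (r : ℝ) :
    Integrable (fun z : ℂ => ‖c + r * z‖ ^ 2) complexGaussian ∧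
      ∫ z, ‖c + r * z‖ ^ 2 ∂complexGaussian = ‖c‖ ^ 2 + r ^ 2 := by
  obtain ⟨i1, i2⟩ := integrable_gaussianReal_half
  have hre := Complex.measurable_re.aemeasurable (μ := complexGaussian)
  have him := Complex.measurable_im.aemeasurable (μ := complexGaussian)
  have r1 : Integrable (fun z : ℂ => z.re) complexGaussian := by
    rw [← map_re_complexGaussian] at i1; exact i1.comp_aemeasurable hre
  have r2 : Integrable (fun z : ℂ => z.re ^ 2) complexGaussian := by
    rw [← map_re_complexGaussian] at i2; exact i2.comp_aemeasurable hre
  have s1 : Integrable (fun z : ℂ => z.im) complexGaussian := by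
    rw [← map_im_complexGaussian] at i1; exact i1.comp_aemeasurable him
  have s2 : Integrable (fun z : ℂ => z.im ^ 2) complexGaussian := by
    rw [← map_im_complexGaussian] at i2; exact i2.comp_aemeasurable him
  have er1 : ∫ z : ℂ, z.re ∂complexGaussian = 0 := by
    have := integral_map hre (f := fun x : ℝ => x) (by fun_prop)
    rw [← this, map_re_complexGaussian]; simp
  have es1 : ∫ z : ℂ, z.im ∂complexGaussian = 0 := by
    have := integral_map him (f := fun x : ℝ => x) (by fun_prop)
    rw [← this, map_im_complexGaussian]; simp
  have er2 : ∫ z : ℂ, z.re ^ 2 ∂complexGaussian = 1 / 2 := by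
    have := integral_map hre (f := fun x : ℝ => x ^ 2) (by fun_prop)
    rw [← this, map_re_complexGaussian, integral_sq_gaussianReal_half]
  have es2 : ∫ z : ℂ, z.im ^ 2 ∂complexGaussian = 1 / 2 := by
    have := integral_map him (f := fun x : ℝ => x ^ 2) (by fun_prop)
    rw [← this, map_im_complexGaussian, integral_sq_gaussianReal_half]
  have key : (fun z : ℂ => ‖c + r * z‖ ^ 2) = fun z : ℂ =>
      ‖c‖ ^ 2 + (2 * r * c.re * z.re + (2 * r * c.im * z.im +
        (r ^ 2 * z.re ^ 2 + r ^ 2 * z.im ^ 2))) := by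
    funext z
    rw [← Complex.normSq_eq_norm_sq, ← Complex.normSq_eq_norm_sq]
    simp [Complex.normSq_apply]
    ring
  rw [key]
  have j4 : Integrable (fun z : ℂ => r ^ 2 * z.re ^ 2 + r ^ 2 * z.im ^ 2) complexGaussian :=
    (r2.const_mul (r ^ 2)).add (s2.const_mul (r ^ 2))
  have j3 : Integrable (fun z : ℂ => 2 * r * c.im * z.im +
      (r ^ 2 * z.re ^ 2 + r ^ 2 * z.im ^ 2)) complexGaussian := (s1.const_mul (2 * r * c.im)).add j4
  have j2 : Integrable (fun z : ℂ => 2 * r * c.re * z.re + (2 * r * c.im * z.im +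
      (r ^ 2 * z.re ^ 2 + r ^ 2 * z.im ^ 2))) complexGaussian := (r1.const_mul (2 * r * c.re)).add j3
  refine ⟨(integrable_const _).add j2, ?_⟩
  rw [integral_add (integrable_const _) j2, integral_add (r1.const_mul _) j3,
    integral_add (s1.const_mul _) j4, integral_add (r2.const_mul _) (s2.const_mul _)]
  simp only [integral_const_mul, er1, er2, es1, es2]
  simp
  ring

/-- Second moment of an affine function of a standard complex Gaussian vector. -/
lemma gaussianVector_second_moment {m : ℕ} (c : ℂ) (a : Fin m → ℂ) :
    Integrable (fun z : Fin m → ℂ => ‖c + ∑ l, z l * a l‖ ^ 2) (gaussianVector m) ∧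
      ∫ z, ‖c + ∑ l, z l * a l‖ ^ 2 ∂(gaussianVector m) = ‖c‖ ^ 2 + ∑ l, ‖a l‖ ^ 2 := by
  have hm : AEMeasurable (fun z : Fin m → ℂ => ∑ l, z l * a l) (gaussianVector m) :=
    Measurable.aemeasurable (by fun_prop)
  have hm2 : AEMeasurable (fun z : ℂ => ((Real.sqrt (∑ l, ‖a l‖ ^ 2) : ℝ) : ℂ) * z)
    complexGaussian := by fun_prop
  obtain ⟨h1, h2⟩ := complexGaussian_second_moment c (Real.sqrt (∑ l, ‖a l‖ ^ 2))
  have hF : ∀ μ : Measure ℂ, AEStronglyMeasurable (fun w : ℂ => ‖c + w‖ ^ 2) μ := fun μ => by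
    fun_prop
  have e1 := integrable_map_measure (hF _) hm
  have e2 := integrable_map_measure (hF _) hm2
  have f1 := integral_map hm (hF _)
  have f2 := integral_map hm2 (hF _)
  rw [gaussianVector_map_dotProduct] at e1 f1
  refine ⟨e1.mp (e2.mpr h1), ?_⟩
  rw [← f1, f2, h2, Real.sq_sqrt (by positivity)]

/-! ### The log-determinant of a Gram matrix -/

section GramDeterminant

open scoped ComplexOrder

lemma trace_conjTranspose_mul_self_re {ι κ : Type*} [Fintype ι] [Fintype κ]
    (H : Matrix κ ι ℂ) :
    (Hᴴ * H).trace.re = ∑ k, ∑ l, ‖H k l‖ ^ 2 := by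
  rw [Finset.sum_comm]
  simp only [Matrix.trace, Matrix.diag, Matrix.mul_apply, Matrix.conjTranspose_apply, Complex.re_sum]
  refine Finset.sum_congr rfl fun l _ => Finset.sum_congr rfl fun k _ => ?_
  rw [← Complex.normSq_eq_norm_sq]
  simp [Complex.normSq_apply]

section Det

variable {ι κ : Type*} [Fintype ι] [DecidableEq ι] [Fintype κ]

lemma exists_unitary_diagonal (A : Matrix ι ι ℂ) (hA : A.PosSemidef) :
    ∃ (U : Matrix ι ι ℂ) (d : ι → ℝ), U * Uᴴ = 1 ∧ (∀ i, 0 ≤ d i) ∧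
      A = U * Matrix.diagonal (fun i => (d i : ℂ)) * Uᴴ := by
  refine ⟨hA.isHermitian.eigenvectorUnitary, hA.isHermitian.eigenvalues,
    Unitary.mul_star_self_of_mem hA.isHermitian.eigenvectorUnitary.2, hA.eigenvalues_nonneg, ?_⟩
  have h := hA.isHermitian.spectral_theorem
  rw [Unitary.conjStarAlgAut_apply] at h
  exact h

lemma one_add_smul_eq_conj (U : Matrix ι ι ℂ) (hU : U * Uᴴ = 1) (d : ι → ℝ) (P : ℝ) :
    1 + (P : ℂ) • (U * Matrix.diagonal (fun i => (d i : ℂ)) * Uᴴ) =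
      U * Matrix.diagonal (fun i => ((1 + P * d i : ℝ) : ℂ)) * Uᴴ := by
  have : Matrix.diagonal (fun i => ((1 + P * d i : ℝ) : ℂ)) =
      1 + (P : ℂ) • Matrix.diagonal (fun i => (d i : ℂ)) := by
    ext i j
    by_cases h : i = j
    · subst h; simp
    · simp [h]
  rw [this, Matrix.mul_add, Matrix.add_mul, Matrix.mul_one, hU]
  simp

lemma det_conj_diagonal (U : Matrix ι ι ℂ) (hU : U * Uᴴ = 1) (D : Matrix ι ι ℂ) :
    (U * D * Uᴴ).det = D.det := by
  rw [Matrix.det_mul, Matrix.det_mul, mul_comm U.det, mul_assoc, ← Matrix.det_mul, hU,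
    Matrix.det_one, mul_one]

/-- `0 ≤ log |I + P A| ≤ tr (I + P A) / c - dim + dim log c` for `A ⪰ 0`: apply `log x ≤ x - 1` to
the eigenvalues divided by `c`. -/
lemma log_det_one_add_smul_bounds (A : Matrix ι ι ℂ) (hA : A.PosSemidef) {P c : ℝ} (hP : 0 ≤ P)
    (hc : 0 < c) :
    0 ≤ Real.log (1 + (P : ℂ) • A).det.re ∧
    Real.log (1 + (P : ℂ) • A).det.re ≤
      (Fintype.card ι + P * A.trace.re) / c - Fintype.card ι + Fintype.card ι * Real.log c := by
  obtain ⟨U, d, hU, hd, rfl⟩ := exists_unitary_diagonal A hA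
  have hdet : (1 + (P : ℂ) • (U * Matrix.diagonal (fun i => (d i : ℂ)) * Uᴴ)).det =
      ((∏ i, (1 + P * d i) : ℝ) : ℂ) := by
    rw [one_add_smul_eq_conj U hU, det_conj_diagonal U hU, Matrix.det_diagonal]
    push_cast; rfl
  have htr : (U * Matrix.diagonal (fun i => (d i : ℂ)) * Uᴴ).trace = ((∑ i, d i : ℝ) : ℂ) := by
    rw [Matrix.trace_mul_comm, ← Matrix.mul_assoc, mul_eq_one_comm.mp hU, Matrix.one_mul,
      Matrix.trace_diagonal]
    push_cast; rfl
  have h1 : ∀ i, 1 ≤ 1 + P * d i := fun i => by nlinarith [mul_nonneg hP (hd i)]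
  rw [hdet, htr, Complex.ofReal_re, Complex.ofReal_re,
    Real.log_prod fun i _ => (zero_lt_one.trans_le (h1 i)).ne']
  refine ⟨Finset.sum_nonneg fun i _ => Real.log_nonneg (h1 i), ?_⟩
  have h2 : ∀ i ∈ Finset.univ, Real.log (1 + P * d i) ≤ (1 + P * d i) / c - 1 + Real.log c := by
    intro i _
    have hp : 0 < 1 + P * d i := zero_lt_one.trans_le (h1 i)
    have := Real.log_le_sub_one_of_pos (div_pos hp hc)
    rw [Real.log_div hp.ne' hc.ne'] at this
    linarith
  refine (Finset.sum_le_sum h2).trans_eq ?_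
  rw [Finset.sum_add_distrib, Finset.sum_sub_distrib, ← Finset.sum_div, Finset.sum_add_distrib,
    ← Finset.mul_sum]
  simp

/-- A factorization `I + P A = Cᴴ C` with `B = C⁻¹`; for `A = Hᴴ H` the left-hand side is the
covariance of a received row under Gaussian inputs. -/
lemma exists_covariance_factor (A : Matrix ι ι ℂ) (hA : A.PosSemidef) {P : ℝ} (hP : 0 ≤ P) :
    ∃ C B : Matrix ι ι ℂ, C * B = 1 ∧ Cᴴ * C = 1 + (P : ℂ) • A := by
  obtain ⟨U, d, hU, hd, rfl⟩ := exists_unitary_diagonal A hA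
  have hp : ∀ i, 0 < 1 + P * d i := fun i => by nlinarith [mul_nonneg hP (hd i)]
  refine ⟨Matrix.diagonal (fun i => ((Real.sqrt (1 + P * d i) : ℝ) : ℂ)) * Uᴴ,
    U * Matrix.diagonal (fun i => (((Real.sqrt (1 + P * d i))⁻¹ : ℝ) : ℂ)), ?_, ?_⟩
  · rw [Matrix.mul_assoc, ← Matrix.mul_assoc Uᴴ, mul_eq_one_comm.mp hU, Matrix.one_mul,
      Matrix.diagonal_mul_diagonal, ← Matrix.diagonal_one]
    congr 1
    funext i
    have := (Real.sqrt_pos.mpr (hp i)).ne'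
    rw [← Complex.ofReal_mul, mul_inv_cancel₀ this, Complex.ofReal_one]
  · rw [one_add_smul_eq_conj U hU, Matrix.conjTranspose_mul, Matrix.conjTranspose_conjTranspose,
      Matrix.mul_assoc, ← Matrix.mul_assoc (Matrix.diagonal _)ᴴ, Matrix.diagonal_conjTranspose,
      Matrix.diagonal_mul_diagonal, ← Matrix.mul_assoc]
    congr 3
    funext i
    simp only [Pi.star_apply, RCLike.star_def, Complex.conj_ofReal]
    rw [← Complex.ofReal_mul, Real.mul_self_sqrt (hp i).le]

lemma det_factor_re {C X : Matrix ι ι ℂ} (hX : Cᴴ * C = X) : X.det.re = ‖C.det‖ ^ 2 := by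
  rw [← hX, Matrix.det_mul, Matrix.det_conjTranspose, ← Complex.normSq_eq_norm_sq]
  simp [Complex.normSq_apply]

lemma norm_det_inv_sq {C B X : Matrix ι ι ℂ} (hCB : C * B = 1) (hX : Cᴴ * C = X) :
    0 < X.det.re ∧ ‖B.det‖ ^ 2 = (X.det.re)⁻¹ := by
  have hdet : ‖C.det‖ * ‖B.det‖ = 1 := by
    rw [← norm_mul, ← Matrix.det_mul, hCB, Matrix.det_one, norm_one]
  have h0 : ‖C.det‖ ≠ 0 := left_ne_zero_of_mul_eq_one hdet
  rw [det_factor_re hX]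
  refine ⟨by positivity, ?_⟩
  rw [← inv_eq_of_mul_eq_one_right hdet, inv_pow]

/-- `tr (Bᴴ (I + P Hᴴ H) B)` is the dimension when `B` whitens `I + P Hᴴ H`. -/
lemma trace_whitened {C B : Matrix ι ι ℂ} {H : Matrix κ ι ℂ} {P : ℝ} (hCB : C * B = 1)
    (hC : Cᴴ * C = 1 + (P : ℂ) • (Hᴴ * H)) :
    ∑ a, ∑ b, ‖B a b‖ ^ 2 + P * ∑ k, ∑ l, ‖(H k ᵥ* B) l‖ ^ 2 = Fintype.card ι := by
  have h1 : Bᴴ * B + (P : ℂ) • ((H * B)ᴴ * (H * B)) = 1 := by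
    have h2 : Bᴴ * (Cᴴ * C) * B = 1 := by
      rw [← Matrix.mul_assoc, ← Matrix.conjTranspose_mul, Matrix.mul_assoc, hCB]
      simp
    rw [hC, Matrix.mul_add, Matrix.add_mul] at h2
    rw [← h2, Matrix.conjTranspose_mul]
    simp [Matrix.mul_assoc]
  have h3 := congrArg (fun M => (Matrix.trace M).re) h1
  simp only [Matrix.trace_add, Matrix.trace_smul, Complex.add_re, smul_eq_mul,
    Complex.re_ofReal_mul, Matrix.trace_one, Complex.natCast_re] at h3
  rw [trace_conjTranspose_mul_self_re, trace_conjTranspose_mul_self_re] at h3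
  exact h3

end Det

lemma gaussianMatrix_map_eval {t L : ℕ} (k : Fin t) (l : Fin L) :
    (gaussianMatrix t L).map (fun H => H k l) = complexGaussian := by
  have h3 : (fun H : Fin t → Fin L → ℂ => H k l) =
      (fun h : Fin L → ℂ => h l) ∘ fun H : Fin t → Fin L → ℂ => H k := rfl
  rw [h3, ← Measure.map_map (measurable_pi_apply l) (measurable_pi_apply k),
    gaussianMatrix_map_row, gaussianVector_map_apply]

/-- The Frobenius norm of a Gaussian matrix has second moment `t L`. -/
lemma gaussianMatrix_frobenius {t L : ℕ} :
    Integrable (fun H : Fin t → Fin L → ℂ => ∑ k, ∑ l, ‖H k l‖ ^ 2) (gaussianMatrix t L) ∧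
      ∫ H, ∑ k, ∑ l, ‖H k l‖ ^ 2 ∂(gaussianMatrix t L) = t * L := by
  obtain ⟨h1, h2⟩ := complexGaussian_second_moment 0 1
  simp only [zero_add, Complex.ofReal_one, one_mul, norm_zero, one_pow, ne_eq, OfNat.ofNat_ne_zero,
    not_false_eq_true, zero_pow] at h1 h2
  have hm : ∀ k l, AEMeasurable (fun H : Fin t → Fin L → ℂ => H k l) (gaussianMatrix t L) :=
    fun k l => Measurable.aemeasurable (by fun_prop)
  have hF : ∀ μ : Measure ℂ, AEStronglyMeasurable (fun w : ℂ => ‖w‖ ^ 2) μ := fun μ => by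
    fun_prop
  have hi : ∀ k l, Integrable (fun H : Fin t → Fin L → ℂ => ‖H k l‖ ^ 2) (gaussianMatrix t L) := by
    intro k l
    have := integrable_map_measure (hF _) (hm k l)
    rw [gaussianMatrix_map_eval] at this
    exact this.mp h1
  have he : ∀ k l, ∫ H, ‖H k l‖ ^ 2 ∂(gaussianMatrix t L) = 1 := by
    intro k l
    have := integral_map (hm k l) (hF _)
    rw [gaussianMatrix_map_eval] at this
    rw [← this, h2]
  refine ⟨integrable_finsetSum _ fun k _ => integrable_finsetSum _ fun l _ => hi k l, ?_⟩
  rw [integral_finsetSum _ fun k _ => integrable_finsetSum _ fun l _ => hi k l]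
  simp_rw [integral_finsetSum _ fun l _ => hi _ l, he]
  simp

lemma continuous_det_gram {t L : ℕ} (P : ℝ) : Continuous fun H : Fin t → Fin L → ℂ =>
    (1 + (P : ℂ) • ((Matrix.of H)ᴴ * Matrix.of H)).det.re := by
  have h0 : Continuous fun H : Fin t → Fin L → ℂ => (Matrix.of H : Matrix (Fin t) (Fin L) ℂ) :=
    continuous_id
  fun_prop

lemma det_gram_comm {t L : ℕ} (P : ℝ) (H : Matrix (Fin t) (Fin L) ℂ) :
    (1 + (P : ℂ) • (Hᴴ * H)).det = (1 + (P : ℂ) • (Hᴴᴴ * Hᴴ)).det := by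
  rw [Matrix.conjTranspose_conjTranspose, ← Matrix.smul_mul, Matrix.det_one_add_mul_comm,
    Matrix.mul_smul]

/-- Eigenvalue bounds for `log |I + P Hᴴ H|` from both Gram matrices. -/
lemma log_det_gram_bounds {t L : ℕ} {P c : ℝ} (hP : 0 ≤ P) (hc : 0 < c)
    (H : Matrix (Fin t) (Fin L) ℂ) :
    0 ≤ Real.log (1 + (P : ℂ) • (Hᴴ * H)).det.re ∧
    Real.log (1 + (P : ℂ) • (Hᴴ * H)).det.re ≤
      (L + P * ∑ k, ∑ l, ‖H k l‖ ^ 2) / c - L + L * Real.log c ∧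
    Real.log (1 + (P : ℂ) • (Hᴴ * H)).det.re ≤
      (t + P * ∑ k, ∑ l, ‖H k l‖ ^ 2) / c - t + t * Real.log c := by
  have h1 := log_det_one_add_smul_bounds (Hᴴ * H) (Matrix.posSemidef_conjTranspose_mul_self H) hP hc
  have h2 := log_det_one_add_smul_bounds (Hᴴᴴ * Hᴴ) (Matrix.posSemidef_conjTranspose_mul_self Hᴴ)
    hP hc
  rw [← det_gram_comm, trace_conjTranspose_mul_self_re, Finset.sum_comm] at h2
  rw [trace_conjTranspose_mul_self_re] at h1
  simp only [Fintype.card_fin, Matrix.conjTranspose_apply, norm_star] at h1 h2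
  exact ⟨h1.1, h1.2, h2.2⟩

lemma integrable_log_det {t L : ℕ} {P : ℝ} (hP : 0 ≤ P) :
    Integrable (fun H : Fin t → Fin L → ℂ =>
      Real.log (1 + (P : ℂ) • ((Matrix.of H)ᴴ * Matrix.of H)).det.re) (gaussianMatrix t L) := by
  have hb : Integrable (fun H : Fin t → Fin L → ℂ => (L + P * ∑ k, ∑ l, ‖H k l‖ ^ 2) / 1 - L +
      L * Real.log 1) (gaussianMatrix t L) :=
    (((integrable_const _).add (gaussianMatrix_frobenius.1.const_mul P)).div_const 1
      |>.sub (integrable_const _)).add (integrable_const _)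
  refine hb.mono' ((Real.measurable_log.comp
    (continuous_det_gram P).measurable).aestronglyMeasurable) (ae_of_all _ fun H => ?_)
  obtain ⟨h0, h1, -⟩ := log_det_gram_bounds hP one_pos (Matrix.of H)
  rw [Real.norm_of_nonneg h0]
  exact h1

/-- Jensen's inequality for `log det`, in the two forms obtained from the two Gram matrices
`Hᴴ H`, `H Hᴴ`, whose means are `t I` and `L I`. -/
lemma integral_log_det_le {t L : ℕ} {P : ℝ} (hP : 0 ≤ P) :
    ∫ H, Real.log (1 + (P : ℂ) • ((Matrix.of H)ᴴ * Matrix.of H)).det.re ∂(gaussianMatrix t L) ≤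
      min (L * Real.log (1 + P * t)) (t * Real.log (1 + P * L)) := by
  have hint := integrable_log_det (t := t) (L := L) hP
  have hF := (gaussianMatrix_frobenius (t := t) (L := L))
  have key : ∀ (d e : ℕ), (t * L : ℝ) = d * e →
      (∀ H : Fin t → Fin L → ℂ, Real.log (1 + (P : ℂ) • ((Matrix.of H)ᴴ * Matrix.of H)).det.re ≤
        (d + P * ∑ k, ∑ l, ‖H k l‖ ^ 2) / (1 + P * e) - d + d * Real.log (1 + P * e)) →
      ∫ H, Real.log (1 + (P : ℂ) • ((Matrix.of H)ᴴ * Matrix.of H)).det.re ∂(gaussianMatrix t L) ≤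
        d * Real.log (1 + P * e) := by
    intro d e hde hb
    have i1 : Integrable (fun H : Fin t → Fin L → ℂ => (d + P * ∑ k, ∑ l, ‖H k l‖ ^ 2) / (1 + P * e))
      (gaussianMatrix t L) := ((integrable_const _).add (hF.1.const_mul P)).div_const _
    have i2 : Integrable (fun H : Fin t → Fin L → ℂ =>
      (d + P * ∑ k, ∑ l, ‖H k l‖ ^ 2) / (1 + P * e) - d) (gaussianMatrix t L) :=
      i1.sub (integrable_const _)
    refine (integral_mono hint (i2.add (integrable_const _)) hb).trans ?_
    simp only [Pi.add_apply]
    rw [integral_add i2 (integrable_const _),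
      integral_sub i1 (integrable_const _), integral_div,
      integral_add (integrable_const _) (hF.1.const_mul P), integral_const_mul, hF.2, hde]
    have : (1 + P * e : ℝ) ≠ 0 := by positivity
    simp only [integral_const, probReal_univ, smul_eq_mul, one_mul]
    rw [show (d + P * (d * e) : ℝ) = d * (1 + P * e) by ring, mul_div_cancel_right₀ _ this]
    simp
  refine le_min (key L t (mul_comm _ _) fun H => ?_) (key t L rfl fun H => ?_)
  · exact (log_det_gram_bounds hP (by positivity) (Matrix.of H)).2.1
  · exact (log_det_gram_bounds hP (by positivity) (Matrix.of H)).2.2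

end GramDeterminant

/-! ### Information density and the Neyman–Pearson lemma -/

/-- The information density at the output `Y`, in nats: the logarithm of the likelihood ratio
between the law of `u + Z` and the law of `Z C`, row by row, where `B = C⁻¹` and `Z` is standard
Gaussian. -/
noncomputable def infoDensity {n L : ℕ} (B : Matrix (Fin L) (Fin L) ℂ)
    (u Y : Fin n → Fin L → ℂ) : ℝ :=
  ∑ i, ∑ l, ‖(Y i ᵥ* B) l‖ ^ 2 - ∑ i, ∑ l, ‖Y i l - u i l‖ ^ 2 - n * Real.log (‖B.det‖ ^ 2)

lemma measurable_infoDensity {n L : ℕ} (B : Matrix (Fin L) (Fin L) ℂ) (u : Fin n → Fin L → ℂ) :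
    Measurable (infoDensity B u) := by
  have : ∀ i l, Measurable fun Y : Fin n → Fin L → ℂ => (Y i ᵥ* B) l := fun i l =>
    (measurable_pi_apply l).comp ((measurable_vecMul B).comp (measurable_pi_apply i))
  unfold infoDensity
  fun_prop

lemma measurable_rows_vecMul {n L : ℕ} (C : Matrix (Fin L) (Fin L) ℂ) :
    Measurable fun (Z : Fin n → Fin L → ℂ) i => Z i ᵥ* C :=
  measurable_pi_lambda _ fun i => (measurable_vecMul C).comp (measurable_pi_apply i)

/-- Change of measure from the channel output to the auxiliary output. -/
lemma map_add_withDensity_infoDensity {n L : ℕ} (C B : Matrix (Fin L) (Fin L) ℂ) (hCB : C * B = 1)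
    (u : Fin n → Fin L → ℂ) :
    ((gaussianMatrix n L).map fun Z => u + Z).withDensity
        (fun Y => ENNReal.ofReal (Real.exp (-infoDensity B u Y))) =
      (gaussianMatrix n L).map fun Z i => Z i ᵥ* C := by
  have hm : ∀ i l, Measurable fun Y : Fin n → Fin L → ℂ => (Y i ᵥ* B) l := fun i l =>
    (measurable_pi_apply l).comp ((measurable_vecMul B).comp (measurable_pi_apply i))
  have hdet : 0 < ‖B.det‖ ^ 2 := by
    have h := congrArg Matrix.det hCB
    rw [Matrix.det_mul, Matrix.det_one] at h
    have := norm_pos_iff.mpr (right_ne_zero_of_mul_eq_one h)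
    positivity
  have hd := measurable_infoDensity B u
  rw [gaussianMatrix_map_add, gaussianMatrix_map_vecMul C B hCB,
    ← withDensity_mul _ (by fun_prop) (by fun_prop)]
  congr 1
  funext Y
  rw [Pi.mul_apply, ← ENNReal.ofReal_mul (by positivity), ← Real.exp_add]
  congr 1
  have h : (‖B.det‖ ^ 2) ^ n = Real.exp (n * Real.log (‖B.det‖ ^ 2)) := by
    rw [mul_comm, Real.exp_mul, Real.exp_log hdet, Real.rpow_natCast]
  rw [h, ← Real.exp_add]
  congr 1
  unfold infoDensity
  ring

/-- The Neyman–Pearson lemma: no test beats the threshold test on the information density. -/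
lemma neyman_pearson {n L : ℕ} (C B : Matrix (Fin L) (Fin L) ℂ) (hCB : C * B = 1)
    (u : Fin n → Fin L → ℂ) (γ : ℝ) {D : Set (Fin n → Fin L → ℂ)} (hD : MeasurableSet D) :
    (gaussianMatrix n L).real {Z | u + Z ∈ D} -
        Real.exp γ * (gaussianMatrix n L).real {Z | (fun i => Z i ᵥ* C) ∈ D} ≤
      (gaussianMatrix n L).real {Z | γ < infoDensity B u (u + Z)} -
        Real.exp γ * (gaussianMatrix n L).real {Z | γ < infoDensity B u fun i => Z i ᵥ* C} := by
  have hu : Measurable fun Z : Fin n → Fin L → ℂ => u + Z := measurable_const_add u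
  have hC := measurable_rows_vecMul (n := n) C
  set p := (gaussianMatrix n L).map fun Z => u + Z with hp
  set q := (gaussianMatrix n L).map fun Z i => Z i ᵥ* C with hq
  have hpP : IsProbabilityMeasure p := Measure.isProbabilityMeasure_map hu.aemeasurable
  have hqP : IsProbabilityMeasure q := Measure.isProbabilityMeasure_map hC.aemeasurable
  set E : Set (Fin n → Fin L → ℂ) := {Y | γ < infoDensity B u Y} with hEd
  have hE : MeasurableSet E := measurableSet_lt measurable_const (measurable_infoDensity B u)
  have hreal : ∀ S : Set (Fin n → Fin L → ℂ), MeasurableSet S →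
      p.real S = (gaussianMatrix n L).real {Z | u + Z ∈ S} ∧
      q.real S = (gaussianMatrix n L).real {Z | (fun i => Z i ᵥ* C) ∈ S} := by
    intro S hS
    exact ⟨map_measureReal_apply hu hS, map_measureReal_apply hC hS⟩
  have hpq : ∀ S, MeasurableSet S →
      q S = ∫⁻ Y in S, ENNReal.ofReal (Real.exp (-infoDensity B u Y)) ∂p := by
    intro S hS
    rw [hq, ← map_add_withDensity_infoDensity C B hCB u, withDensity_apply _ hS]
  -- off `E` the density of `q` relative to `p` is at least `exp (-γ)`, on `E` it is at most that
  have hle1 : p.real (D \ E) ≤ Real.exp γ * q.real (D \ E) := by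
    have h1 : ENNReal.ofReal (Real.exp (-γ)) * p (D \ E) ≤ q (D \ E) := by
      rw [hpq _ (hD.diff hE), ← setLIntegral_const]
      refine setLIntegral_mono' (hD.diff hE) fun Y hY => ?_
      refine ENNReal.ofReal_le_ofReal (Real.exp_le_exp.mpr (neg_le_neg ?_))
      exact not_lt.mp hY.2
    have h2 := ENNReal.toReal_mono (measure_ne_top q _) h1
    rw [ENNReal.toReal_mul, ENNReal.toReal_ofReal (Real.exp_pos _).le, Real.exp_neg] at h2
    have h3 := Real.exp_pos γ
    rw [inv_mul_le_iff₀ h3] at h2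
    exact h2
  have hle2 : Real.exp γ * q.real (E \ D) ≤ p.real (E \ D) := by
    have h1 : q (E \ D) ≤ ENNReal.ofReal (Real.exp (-γ)) * p (E \ D) := by
      rw [hpq _ (hE.diff hD), ← setLIntegral_const]
      refine setLIntegral_mono' (hE.diff hD) fun Y hY => ?_
      refine ENNReal.ofReal_le_ofReal (Real.exp_le_exp.mpr (neg_le_neg ?_))
      exact le_of_lt hY.1
    have h2 := ENNReal.toReal_mono
      (ENNReal.mul_ne_top ENNReal.ofReal_ne_top (measure_ne_top p _)) h1
    rw [ENNReal.toReal_mul, ENNReal.toReal_ofReal (Real.exp_pos _).le, Real.exp_neg] at h2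
    have h3 := Real.exp_pos γ
    rw [← div_eq_inv_mul, le_div_iff₀ h3] at h2
    rw [mul_comm]
    exact h2
  rw [← (hreal D hD).1, ← (hreal D hD).2]
  change _ ≤ (gaussianMatrix n L).real {Z | u + Z ∈ E} -
    Real.exp γ * (gaussianMatrix n L).real {Z | (fun i => Z i ᵥ* C) ∈ E}
  rw [← (hreal E hE).1, ← (hreal E hE).2]
  rw [← measureReal_inter_add_sdiff (μ := p) (s := D) hE,
    ← measureReal_inter_add_sdiff (μ := q) (s := D) hE,
    ← measureReal_inter_add_sdiff (μ := p) (s := E) hD,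
    ← measureReal_inter_add_sdiff (μ := q) (s := E) hD, Set.inter_comm E D]
  linarith

/-- The mean of the information density given the transmitted signal. -/
lemma integral_infoDensity {n L : ℕ} (B : Matrix (Fin L) (Fin L) ℂ) (u : Fin n → Fin L → ℂ) :
    Integrable (fun Z => infoDensity B u (u + Z)) (gaussianMatrix n L) ∧
    ∫ Z, infoDensity B u (u + Z) ∂(gaussianMatrix n L) =
      ∑ i, ∑ l, ‖(u i ᵥ* B) l‖ ^ 2 + n * ∑ a, ∑ b, ‖B a b‖ ^ 2 - n * L -
        n * Real.log (‖B.det‖ ^ 2) := by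
  have hterm : ∀ i l, Integrable (fun Z : Fin n → Fin L → ℂ => ‖((u + Z) i ᵥ* B) l‖ ^ 2)
      (gaussianMatrix n L) ∧ ∫ Z, ‖((u + Z) i ᵥ* B) l‖ ^ 2 ∂(gaussianMatrix n L) =
        ‖(u i ᵥ* B) l‖ ^ 2 + ∑ a, ‖B a l‖ ^ 2 := by
    intro i l
    obtain ⟨h1, h2⟩ := gaussianVector_second_moment ((u i ᵥ* B) l) fun a => B a l
    have hm : AEMeasurable (fun Z : Fin n → Fin L → ℂ => Z i) (gaussianMatrix n L) :=
      (measurable_pi_apply i).aemeasurable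
    have hF : ∀ μ : Measure (Fin L → ℂ), AEStronglyMeasurable (fun z : Fin L → ℂ =>
        ‖(u i ᵥ* B) l + ∑ a, z a * B a l‖ ^ 2) μ := fun μ =>
      Measurable.aestronglyMeasurable (by fun_prop)
    have e1 := integrable_map_measure (hF _) hm
    have f1 := integral_map hm (hF _)
    rw [gaussianMatrix_map_row] at e1 f1
    have he : (fun Z : Fin n → Fin L → ℂ => ‖((u + Z) i ᵥ* B) l‖ ^ 2) =
        fun Z => ‖(u i ᵥ* B) l + ∑ a, Z i a * B a l‖ ^ 2 := by
      funext Z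
      rw [Pi.add_apply, Matrix.add_vecMul, Pi.add_apply]
      rfl
    rw [he]
    exact ⟨e1.mp h1, by rw [← f1, h2]⟩
  obtain ⟨g1, g2⟩ := gaussianMatrix_frobenius (t := n) (L := L)
  have hi1 : Integrable (fun Z : Fin n → Fin L → ℂ => ∑ i, ∑ l, ‖((u + Z) i ᵥ* B) l‖ ^ 2)
      (gaussianMatrix n L) :=
    integrable_finsetSum _ fun i _ => integrable_finsetSum _ fun l _ => (hterm i l).1
  have hi2 : Integrable (fun Z : Fin n → Fin L → ℂ => ∑ i, ∑ l, ‖((u + Z) i ᵥ* B) l‖ ^ 2 -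
      ∑ i, ∑ l, ‖Z i l‖ ^ 2) (gaussianMatrix n L) := hi1.sub g1
  have heq : (fun Z => infoDensity B u (u + Z)) = fun Z : Fin n → Fin L → ℂ =>
      ∑ i, ∑ l, ‖((u + Z) i ᵥ* B) l‖ ^ 2 - ∑ i, ∑ l, ‖Z i l‖ ^ 2 -
        n * Real.log (‖B.det‖ ^ 2) := by
    funext Z
    simp [infoDensity]
  rw [heq]
  refine ⟨hi2.sub (integrable_const _), ?_⟩
  rw [integral_sub hi2 (integrable_const _), integral_sub hi1 g1, g2,
    integral_finsetSum _ fun i _ => integrable_finsetSum _ fun l _ => (hterm i l).1]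
  simp_rw [integral_finsetSum _ fun l _ => (hterm _ l).1, (hterm _ _).2, Finset.sum_add_distrib]
  rw [Finset.sum_comm (s := Finset.univ) (t := Finset.univ) (f := fun a b => ‖B a b‖ ^ 2)]
  simp

/-! ### Averages over independent messages -/

section Finite

variable {κ : Type*} [Fintype κ] [DecidableEq κ] {M : ℕ}

/-- Averaging over all messages is unchanged when one of them is drawn afresh. -/
lemma sum_resample {R : Type*} [Semiring R] (k : κ) (g : (κ → Fin M) → R) :
    (M : R) * ∑ s, g s = ∑ s, ∑ m, g (Function.update s k m) := by
  let e := Equiv.funSplitAt k (Fin M)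
  rw [← e.symm.sum_comp g, ← e.symm.sum_comp, Fintype.sum_prod_type, Fintype.sum_prod_type]
  have : ∀ (m' m : Fin M) r, Function.update (e.symm (m', r)) k m = e.symm (m, r) := by
    intro m' m r
    funext j
    by_cases h : j = k
    · subst h; simp [e]
    · simp [e, h]
  simp_rw [this]
  rw [Finset.sum_const, Finset.card_univ, Fintype.card_fin, nsmul_eq_mul, Finset.sum_comm]

/-- Independent centred contributions are uncorrelated. -/
lemma sum_norm_sq_of_centred (v : κ → Fin M → ℂ) (hv : ∀ k, ∑ m, v k m = 0) :
    (M : ℝ) * ∑ s : κ → Fin M, ‖∑ k, v k (s k)‖ ^ 2 =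
      (M : ℝ) ^ Fintype.card κ * ∑ k, ∑ m, ‖v k m‖ ^ 2 := by
  have hsq : ∀ z : ℂ, ((‖z‖ ^ 2 : ℝ) : ℂ) = z * (starRingEnd ℂ) z := by
    intro z
    rw [Complex.mul_conj, Complex.normSq_eq_norm_sq]
  have hcross : ∀ k j, (M : ℂ) * ∑ s : κ → Fin M, v k (s k) * (starRingEnd ℂ) (v j (s j)) =
      if k = j then (M : ℂ) ^ Fintype.card κ * ∑ m, ((‖v k m‖ ^ 2 : ℝ) : ℂ) else 0 := by
    intro k j
    rw [sum_resample k]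
    split_ifs with h
    · subst h
      simp [hsq]
    · refine Finset.sum_eq_zero fun s _ => ?_
      simp only [Function.update_self, Function.update_of_ne (Ne.symm h)]
      rw [← Finset.sum_mul, hv, zero_mul]
  have : (((M : ℝ) * ∑ s : κ → Fin M, ‖∑ k, v k (s k)‖ ^ 2 : ℝ) : ℂ) =
      (((M : ℝ) ^ Fintype.card κ * ∑ k, ∑ m, ‖v k m‖ ^ 2 : ℝ) : ℂ) := by
    rw [Complex.ofReal_mul, Complex.ofReal_sum]
    simp_rw [hsq, map_sum, Finset.sum_mul_sum]
    rw [Finset.sum_comm]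
    simp_rw [Finset.sum_comm (s := (Finset.univ : Finset (κ → Fin M))), Finset.mul_sum]
    simp_rw [← Finset.mul_sum, Complex.ofReal_natCast]
    rw [Finset.mul_sum]
    simp_rw [Finset.mul_sum (s := (Finset.univ : Finset κ)), hcross]
    simp [Finset.mul_sum]
  exact_mod_cast this

/-- If the decisions do not depend on the messages, each of them is right for one message in `M`
at most. -/
lemma sum_prod_correct_le (d : κ → Option (Fin M)) {b : ℝ} (hb : 0 ≤ b) :
    ∑ s : κ → Fin M, ∏ k, (1 + b * if d k = some (s k) then 1 else 0) ≤
      ((M : ℝ) + b) ^ Fintype.card κ := by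
  have h := Finset.prod_univ_sum (fun _ : κ => (Finset.univ : Finset (Fin M)))
    (fun k m => 1 + b * if d k = some m then (1 : ℝ) else 0)
  rw [Fintype.piFinset_univ] at h
  rw [← h]
  have hle : ∀ k ∈ (Finset.univ : Finset κ),
      ∑ m, (1 + b * if d k = some m then (1 : ℝ) else 0) ≤ M + b := by
    intro k _
    rw [Finset.sum_add_distrib, ← Finset.mul_sum]
    have : ∑ m : Fin M, (if d k = some m then (1 : ℝ) else 0) ≤ 1 := by
      cases hk : d k with
      | none => simp
      | some m => simp
    simp only [Finset.sum_const, Finset.card_univ, Fintype.card_fin, nsmul_eq_mul, mul_one]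
    nlinarith
  calc _ ≤ ∏ _k : κ, ((M : ℝ) + b) := Finset.prod_le_prod (fun k _ => Finset.sum_nonneg
        fun m _ => by positivity) hle
    _ = _ := by simp

end Finite

/-! ### Fano's inequality for a fixed channel matrix -/

section Fano

variable {κ : Type*} [Fintype κ] [DecidableEq κ] {M n L : ℕ}

/-- The noiseless received matrix when user `k` sends the message `s k`. -/
def superposition (H : κ → Fin L → ℂ) (x : κ → Fin M → Fin n → ℂ) (s : κ → Fin M) :
    Fin n → Fin L → ℂ := fun i l => ∑ k, H k l * x k (s k) i

/-- Averaged over the messages, the whitened signal energy is at most that of independent symbols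
of power `P`. -/
lemma sum_energy_superposition_le (H : κ → Fin L → ℂ) (B : Matrix (Fin L) (Fin L) ℂ) {P : ℝ}
    (hM : 0 < M) (x : κ → Fin M → Fin n → ℂ) (hx : ∀ k i, ∑ m, x k m i = 0)
    (hxP : ∀ k, ∑ m, ∑ i, ‖x k m i‖ ^ 2 ≤ M * (n * P)) :
    ∑ s : κ → Fin M, ∑ i, ∑ l, ‖(superposition H x s i ᵥ* B) l‖ ^ 2 ≤
      (M : ℝ) ^ Fintype.card κ * (n * (P * ∑ k, ∑ l, ‖(H k ᵥ* B) l‖ ^ 2)) := by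
  have hM' : (0 : ℝ) < M := by exact_mod_cast hM
  have hlin : ∀ s i l, (superposition H x s i ᵥ* B) l = ∑ k, x k (s k) i * (H k ᵥ* B) l := by
    intro s i l
    simp only [superposition, Matrix.vecMul, dotProduct, Finset.sum_mul, Finset.mul_sum]
    rw [Finset.sum_comm]
    exact Finset.sum_congr rfl fun k _ => Finset.sum_congr rfl fun j _ => by ring
  have hone : ∀ i l, (M : ℝ) * ∑ s : κ → Fin M, ‖(superposition H x s i ᵥ* B) l‖ ^ 2 =
      (M : ℝ) ^ Fintype.card κ * ∑ k, (∑ m, ‖x k m i‖ ^ 2) * ‖(H k ᵥ* B) l‖ ^ 2 := by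
    intro i l
    simp_rw [hlin]
    rw [sum_norm_sq_of_centred (fun k m => x k m i * (H k ᵥ* B) l) fun k => by
      rw [← Finset.sum_mul, hx, zero_mul]]
    simp_rw [norm_mul, mul_pow, Finset.sum_mul]
  have htot : (M : ℝ) * ∑ s : κ → Fin M, ∑ i, ∑ l, ‖(superposition H x s i ᵥ* B) l‖ ^ 2 =
      (M : ℝ) ^ Fintype.card κ *
        ∑ k, (∑ m, ∑ i, ‖x k m i‖ ^ 2) * ∑ l, ‖(H k ᵥ* B) l‖ ^ 2 := by
    rw [Finset.sum_comm]
    simp_rw [Finset.sum_comm (s := (Finset.univ : Finset (κ → Fin M))), Finset.mul_sum]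
    simp_rw [← Finset.mul_sum]
    rw [Finset.mul_sum]
    simp_rw [Finset.mul_sum (s := (Finset.univ : Finset (Fin L))), hone]
    simp_rw [← Finset.mul_sum]
    congr 1
    simp_rw [Finset.sum_comm (t := (Finset.univ : Finset κ))]
    refine Finset.sum_congr rfl fun k _ => ?_
    simp_rw [← Finset.mul_sum, ← Finset.sum_mul]
    rw [Finset.sum_comm]
  have hle : ∑ k, (∑ m, ∑ i, ‖x k m i‖ ^ 2) * ∑ l, ‖(H k ᵥ* B) l‖ ^ 2 ≤
      ∑ k, (M * (n * P)) * ∑ l, ‖(H k ᵥ* B) l‖ ^ 2 :=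
    Finset.sum_le_sum fun k _ => mul_le_mul_of_nonneg_right (hxP k) (by positivity)
  rw [← Finset.mul_sum] at hle
  refine le_of_mul_le_mul_left ?_ hM'
  rw [htot]
  calc _ ≤ (M : ℝ) ^ Fintype.card κ * (M * (n * P) * ∑ k, ∑ l, ‖(H k ᵥ* B) l‖ ^ 2) :=
        mul_le_mul_of_nonneg_left hle (by positivity)
    _ = _ := by ring

/-- Fano-type inequality for a fixed channel matrix and centred codebooks. The number of correctly
decoded users is tested against the auxiliary output law, under which decisions are independent of
the messages; `X ≤ exp X - 1` plays the role of the variational formula for relative entropy. -/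
lemma fano_fixed_channel_centred (H : Matrix κ (Fin L) ℂ) {P a : ℝ} (hP : 0 ≤ P) (ha : 0 ≤ a)
    (hM : 0 < M) (x : κ → Fin M → Fin n → ℂ) (hx : ∀ k i, ∑ m, x k m i = 0)
    (hxP : ∀ k, ∑ m, ∑ i, ‖x k m i‖ ^ 2 ≤ M * (n * P))
    (d : κ → (Fin n → Fin L → ℂ) → Option (Fin M))
    (hd : ∀ k m, MeasurableSet {y | d k y = some m}) :
    a * ∑ s : κ → Fin M, ∑ k,
        (gaussianMatrix n L).real {Z | d k (superposition H x s + Z) = some (s k)} ≤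
      (M : ℝ) ^ Fintype.card κ * (n * Real.log (1 + (P : ℂ) • (Hᴴ * H)).det.re +
        Fintype.card κ * Real.log (1 + (Real.exp a - 1) / M)) := by
  have hM' : (0 : ℝ) < M := by exact_mod_cast hM
  obtain ⟨C, B, hCB, hC⟩ := by
    open scoped ComplexOrder in
    exact exists_covariance_factor (Hᴴ * H) (Matrix.posSemidef_conjTranspose_mul_self H) hP
  obtain ⟨hDpos, hBdet⟩ := norm_det_inv_sq hCB hC
  have htr := trace_whitened hCB hC
  set D := (1 + (P : ℂ) • (Hᴴ * H)).det.re with hD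
  set b := Real.exp a - 1 with hb
  have hb0 : 0 ≤ b := by rw [hb]; linarith [Real.add_one_le_exp a]
  set c₀ := (Fintype.card κ : ℝ) * Real.log (1 + b / M) with hc₀
  have hbM : 0 < 1 + b / M := by positivity
  set u := superposition H x with hu
  set N := (M : ℝ) ^ Fintype.card κ with hN
  have hexpc : N * Real.exp c₀ = ((M : ℝ) + b) ^ Fintype.card κ := by
    rw [hc₀, mul_comm (Fintype.card κ : ℝ), Real.exp_mul, Real.exp_log hbM, Real.rpow_natCast, hN,
      ← mul_pow]
    congr 1
    field_simp
  -- the tilted number of correct decisions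
  let F : (κ → Fin M) → (Fin n → Fin L → ℂ) → ℝ := fun s y =>
    ∏ k, (1 + b * if d k y = some (s k) then 1 else 0)
  have hFpos : ∀ s y, 0 < F s y := fun s y => Finset.prod_pos fun k _ => by
    split_ifs <;> nlinarith
  have hFlog : ∀ s y, Real.log (F s y) = a * ∑ k, if d k y = some (s k) then 1 else 0 := by
    intro s y
    rw [Real.log_prod fun k _ => by split_ifs <;> nlinarith, Finset.mul_sum]
    refine Finset.sum_congr rfl fun k _ => ?_
    split_ifs
    · simp [hb]
    · simp
  have hind : ∀ k m, Measurable fun y : Fin n → Fin L → ℂ => if d k y = some m then (1 : ℝ) else 0 :=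
    fun k m => Measurable.ite (hd k m) measurable_const measurable_const
  have hFm : ∀ s, Measurable (F s) := by
    intro s
    have := fun k => hind k (s k)
    fun_prop
  set γ := gaussianMatrix n L with hγ
  have hshift : ∀ s, Measurable fun Z : Fin n → Fin L → ℂ => u s + Z :=
    fun s => measurable_const_add _
  have hCm := measurable_rows_vecMul (n := n) C
  -- under the auxiliary law the tilted count no longer involves the signal
  have hcm : ∀ s, ∫⁻ Z, ENNReal.ofReal (F s (u s + Z) * Real.exp (-infoDensity B (u s) (u s + Z))) ∂γ
      = ∫⁻ Z, ENNReal.ofReal (F s fun i => Z i ᵥ* C) ∂γ := by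
    intro s
    have hm1 := (hFm s).ennreal_ofReal
    have hm2 : Measurable fun Y => ENNReal.ofReal (Real.exp (-infoDensity B (u s) Y)) :=
      (measurable_infoDensity B (u s)).neg.exp.ennreal_ofReal
    rw [← lintegral_map hm1 hCm, ← map_add_withDensity_infoDensity C B hCB (u s),
      lintegral_withDensity_eq_lintegral_mul _ hm2 hm1, lintegral_map (hm2.mul hm1) (hshift s)]
    refine lintegral_congr fun Z => ?_
    rw [Pi.mul_apply, ← ENNReal.ofReal_mul (Real.exp_pos _).le, mul_comm]
  have hFint : ∀ s, Integrable (fun Z : Fin n → Fin L → ℂ => F s fun i => Z i ᵥ* C) γ := by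
    intro s
    refine Integrable.of_bound ((hFm s).comp hCm).aestronglyMeasurable
      ((1 + b) ^ Fintype.card κ) (ae_of_all _ fun Z => ?_)
    rw [Real.norm_of_nonneg (hFpos s _).le]
    calc F s (fun i => Z i ᵥ* C) ≤ ∏ _k : κ, (1 + b) :=
          Finset.prod_le_prod (fun k _ => by positivity) fun k _ => by split_ifs <;> simp [hb0]
      _ = _ := by simp
  have hmE : ∀ s, Measurable fun Z : Fin n → Fin L → ℂ =>
      F s (u s + Z) * Real.exp (-infoDensity B (u s) (u s + Z)) := fun s =>
    ((hFm s).comp (hshift s)).mul ((measurable_infoDensity B (u s)).comp (hshift s)).neg.exp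
  have hEnn : ∀ s Z, 0 ≤ F s (u s + Z) * Real.exp (-infoDensity B (u s) (u s + Z)) := fun s Z =>
    mul_nonneg (hFpos _ _).le (Real.exp_pos _).le
  have hEeq : ∀ s, ∫ Z, F s (u s + Z) * Real.exp (-infoDensity B (u s) (u s + Z)) ∂γ =
      ∫ Z, F s (fun i => Z i ᵥ* C) ∂γ := by
    intro s
    rw [integral_eq_lintegral_of_nonneg_ae (ae_of_all _ (hEnn s)) (hmE s).aestronglyMeasurable,
      integral_eq_lintegral_of_nonneg_ae (ae_of_all _ fun Z => (hFpos s _).le)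
        (hFint s).aestronglyMeasurable, hcm]
  have hEint : ∀ s, Integrable (fun Z : Fin n → Fin L → ℂ =>
      F s (u s + Z) * Real.exp (-infoDensity B (u s) (u s + Z))) γ := by
    intro s
    refine ⟨(hmE s).aestronglyMeasurable, ?_⟩
    rw [hasFiniteIntegral_iff_ofReal (ae_of_all _ (hEnn s)), hcm,
      ← hasFiniteIntegral_iff_ofReal (ae_of_all _ fun Z => (hFpos s _).le)]
    exact (hFint s).2
  have hEsum : ∑ s, ∫ Z, F s (u s + Z) * Real.exp (-infoDensity B (u s) (u s + Z)) ∂γ ≤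
      N * Real.exp c₀ := by
    simp_rw [hEeq]
    rw [← integral_finsetSum _ fun s _ => hFint s, hexpc]
    have : ∫ Z : Fin n → Fin L → ℂ, ((M : ℝ) + b) ^ Fintype.card κ ∂γ =
      ((M : ℝ) + b) ^ Fintype.card κ := by simp
    rw [← this]
    exact integral_mono (integrable_finsetSum _ fun s _ => hFint s) (integrable_const _)
      fun Z => sum_prod_correct_le (fun k => d k fun i => Z i ᵥ* C) hb0
  -- the mean number of correct decisions
  have hcount : ∀ s, Integrable (fun Z => ∑ k, if d k (u s + Z) = some (s k) then (1 : ℝ) else 0) γ ∧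
      ∫ Z, ∑ k, (if d k (u s + Z) = some (s k) then (1 : ℝ) else 0) ∂γ =
        ∑ k, γ.real {Z | d k (u s + Z) = some (s k)} := by
    intro s
    have hset : ∀ k, MeasurableSet {Z | d k (u s + Z) = some (s k)} := fun k =>
      hshift s (hd k (s k))
    have hi : ∀ k, (fun Z => if d k (u s + Z) = some (s k) then (1 : ℝ) else 0) =
        {Z | d k (u s + Z) = some (s k)}.indicator 1 := by
      intro k; funext Z; simp [Set.indicator_apply]
    have h1 : ∀ k, Integrable (fun Z => if d k (u s + Z) = some (s k) then (1 : ℝ) else 0) γ := by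
      intro k
      rw [hi]
      exact (integrable_const (1 : ℝ)).indicator (hset k)
    refine ⟨integrable_finsetSum _ fun k _ => h1 k, ?_⟩
    rw [integral_finsetSum _ fun k _ => h1 k]
    refine Finset.sum_congr rfl fun k _ => ?_
    rw [hi, integral_indicator_one (hset k)]
  -- `X ≤ exp X - 1` for `X = a * #correct - infoDensity - c₀`, integrated over the noise
  have hpt : ∀ s, a * (∑ k, γ.real {Z | d k (u s + Z) = some (s k)}) -
      ∫ Z, infoDensity B (u s) (u s + Z) ∂γ - c₀ ≤
      Real.exp (-c₀) * (∫ Z, F s (u s + Z) * Real.exp (-infoDensity B (u s) (u s + Z)) ∂γ) - 1 := by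
    intro s
    rw [← (hcount s).2, ← integral_const_mul, ← integral_const_mul]
    have i1 := (hcount s).1.const_mul a
    have i2 := (integral_infoDensity B (u s)).1
    have i3 := (hEint s).const_mul (Real.exp (-c₀))
    have i12 : Integrable (fun Z => a * ∑ k, (if d k (u s + Z) = some (s k) then (1 : ℝ) else 0) -
      infoDensity B (u s) (u s + Z)) γ := i1.sub i2
    have e1 : ∀ c : ℝ, ∫ _Z, c ∂γ = c := fun c => by simp
    rw [← integral_sub i1 i2]
    have hle := integral_mono (i12.sub (integrable_const c₀)) (i3.sub (integrable_const 1))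
      fun Z => ?_
    · simp only [Pi.sub_apply] at hle
      rwa [integral_sub i12 (integrable_const _), integral_sub i3 (integrable_const _), e1, e1]
        at hle
    have h := Real.add_one_le_exp (Real.log (F s (u s + Z)) -
      infoDensity B (u s) (u s + Z) - c₀)
    rw [sub_eq_add_neg _ c₀, Real.exp_add, sub_eq_add_neg (Real.log _), Real.exp_add,
      Real.exp_log (hFpos _ _), hFlog] at h
    simp only [Pi.sub_apply]
    linarith
  have hsum := Finset.sum_le_sum fun s (_ : s ∈ Finset.univ) => hpt s
  simp only [Finset.sum_sub_distrib, ← Finset.mul_sum, Finset.sum_const, Finset.card_univ,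
    nsmul_eq_mul, mul_one] at hsum
  have hNc : ((Fintype.card (κ → Fin M) : ℕ) : ℝ) = N := by simp [hN]
  rw [hNc] at hsum
  have h1 : Real.exp (-c₀) * ∑ s, ∫ Z, F s (u s + Z) * Real.exp (-infoDensity B (u s) (u s + Z)) ∂γ
      ≤ N := by
    calc _ ≤ Real.exp (-c₀) * (N * Real.exp c₀) :=
          mul_le_mul_of_nonneg_left hEsum (Real.exp_pos _).le
      _ = N := by rw [mul_comm, mul_assoc, ← Real.exp_add]; simp
  -- the signal energy and the noise terms of the mean information density cancel by `htr`
  have h2 : ∑ s, ∫ Z, infoDensity B (u s) (u s + Z) ∂γ ≤ N * (n * Real.log D) := by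
    rw [Finset.sum_congr rfl fun s _ => (integral_infoDensity B (u s)).2]
    have h3 := sum_energy_superposition_le H B hM x hx hxP
    simp only [Finset.sum_sub_distrib, Finset.sum_add_distrib, Finset.sum_const, Finset.card_univ,
      nsmul_eq_mul]
    rw [hNc, hBdet, Real.log_inv]
    rw [Fintype.card_fin] at htr
    have h4 : (n : ℝ) * (L : ℝ) = n * ∑ a, ∑ b, ‖B a b‖ ^ 2 +
        n * (P * ∑ k, ∑ l, ‖(H k ᵥ* B) l‖ ^ 2) := by rw [← htr]; ring
    rw [h4]
    have h5 : N * (n * (P * ∑ k, ∑ l, ‖(H k ᵥ* B) l‖ ^ 2)) -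
      N * (n * (P * ∑ k, ∑ l, ‖(H k ᵥ* B) l‖ ^ 2)) = 0 := sub_self _
    nlinarith [h3, h5]
  rw [mul_add]
  linarith

/-- Fano-type inequality for a fixed channel matrix. The mean codewords shift the output by a known
matrix, which the decoder can add back, so the codebooks may be assumed to be centred. -/
lemma fano_fixed_channel (H : Matrix κ (Fin L) ℂ) {P a : ℝ} (hP : 0 ≤ P) (ha : 0 ≤ a)
    (hM : 0 < M) (x : κ → Fin M → Fin n → ℂ) (hxP : ∀ k m, ∑ i, ‖x k m i‖ ^ 2 ≤ n * P)
    (d : κ → (Fin n → Fin L → ℂ) → Option (Fin M))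
    (hd : ∀ k m, MeasurableSet {y | d k y = some m}) :
    a * ∑ s : κ → Fin M, ∑ k,
        (gaussianMatrix n L).real {Z | d k (superposition H x s + Z) = some (s k)} ≤
      (M : ℝ) ^ Fintype.card κ * (n * Real.log (1 + (P : ℂ) • (Hᴴ * H)).det.re +
        Fintype.card κ * Real.log (1 + (Real.exp a - 1) / M)) := by
  have hM' : (0 : ℝ) < M := by exact_mod_cast hM
  let μ : κ → Fin n → ℂ := fun k i => (M : ℂ)⁻¹ * ∑ m, x k m i
  have hsum : ∀ k i, ∑ m, x k m i = M * μ k i := by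
    intro k i
    have : (M : ℂ) ≠ 0 := by exact_mod_cast hM.ne'
    simp only [μ]
    field_simp
  let x' : κ → Fin M → Fin n → ℂ := fun k m i => x k m i - μ k i
  let w : Fin n → Fin L → ℂ := fun i l => ∑ k, H k l * μ k i
  have hx' : ∀ k i, ∑ m, x' k m i = 0 := by
    intro k i
    simp only [x', Finset.sum_sub_distrib, hsum]
    simp
  -- centring does not increase the energy
  have hvar : ∀ k i, ∑ m, ‖x' k m i‖ ^ 2 ≤ ∑ m, ‖x k m i‖ ^ 2 := by
    intro k i
    have h1 : ∀ m, ‖x k m i‖ ^ 2 = ‖x' k m i‖ ^ 2 + ‖μ k i‖ ^ 2 +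
        2 * (x' k m i * (starRingEnd ℂ) (μ k i)).re := by
      intro m
      have : x k m i = x' k m i + μ k i := by simp [x']
      rw [this, ← Complex.normSq_eq_norm_sq, Complex.normSq_add, Complex.normSq_eq_norm_sq,
        Complex.normSq_eq_norm_sq]
    simp_rw [h1, Finset.sum_add_distrib, ← Finset.mul_sum, ← Complex.re_sum, ← Finset.sum_mul]
    rw [hx']
    simp only [zero_mul, Complex.zero_re, mul_zero, add_zero]
    exact le_add_of_nonneg_right (by positivity)
  have hxP' : ∀ k, ∑ m, ∑ i, ‖x' k m i‖ ^ 2 ≤ M * (n * P) := by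
    intro k
    rw [Finset.sum_comm]
    calc _ ≤ ∑ i, ∑ m, ‖x k m i‖ ^ 2 := Finset.sum_le_sum fun i _ => hvar k i
      _ = ∑ m, ∑ i, ‖x k m i‖ ^ 2 := Finset.sum_comm
      _ ≤ ∑ _m : Fin M, (n * P) := Finset.sum_le_sum fun m _ => hxP k m
      _ = _ := by simp
  have hd' : ∀ k m, MeasurableSet {y : Fin n → Fin L → ℂ | d k (w + y) = some m} := fun k m =>
    measurable_const_add w (hd k m)
  have h := fano_fixed_channel_centred H hP ha hM x' hx' hxP' (fun k y => d k (w + y)) hd'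
  have he : ∀ s Z, w + (superposition H x' s + Z) = superposition H x s + Z := by
    intro s Z
    rw [← add_assoc]
    congr 1
    funext i l
    simp only [superposition, Pi.add_apply, w, x', ← Finset.sum_add_distrib]
    exact Finset.sum_congr rfl fun k _ => by ring
  simp_rw [he] at h
  exact h

end Fano

/-! ### The information density of a single user -/

lemma measurable_single_densityTrue {L N : ℕ} (P : ℝ) :
    Measurable (densityTrue P : (Fin L → ℂ) × (Fin N → ℂ) → ℝ) := by
  unfold densityTrue gain
  have h1 : Measurable fun ω : (Fin L → ℂ) × (Fin N → ℂ) => P * ∑ l, ‖ω.1 l‖ ^ 2 := by fun_prop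
  have h2 := Complex.measurable_ofReal.comp h1.sqrt
  simp only [Function.comp_def] at h2
  fun_prop

lemma measurable_single_densityAux {L N : ℕ} (P : ℝ) :
    Measurable (densityAux P : (Fin L → ℂ) × (Fin N → ℂ) → ℝ) := by
  unfold densityAux gain
  have h1 : Measurable fun ω : (Fin L → ℂ) × (Fin N → ℂ) => P * ∑ l, ‖ω.1 l‖ ^ 2 := by fun_prop
  have h2 := Complex.measurable_ofReal.comp h1.sqrt
  have h3 := Complex.measurable_ofReal.comp (h1.const_add 1).sqrt
  simp only [Function.comp_def] at h2 h3
  fun_prop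

section SingleUser

variable {L N : ℕ}

lemma gain_nonneg {P : ℝ} (hP : 0 ≤ P) (h : Fin L → ℂ) : 0 ≤ gain P h :=
  mul_nonneg hP (by positivity)

/-- Sherman–Morrison formula for the whitened length of a received row. -/
lemma whitened_norm_sq {P : ℝ} (hP : 0 ≤ P) (h : Fin L → ℂ) {C B : Matrix (Fin L) (Fin L) ℂ}
    (hCB : C * B = 1) (hC : Cᴴ * C = 1 + (P : ℂ) • Matrix.vecMulVec (star h) h)
    (y : Fin L → ℂ) :
    ∑ l, ‖(y ᵥ* B) l‖ ^ 2 =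
      ∑ l, ‖y l‖ ^ 2 - P / (1 + gain P h) * ‖∑ l, y l * star (h l)‖ ^ 2 := by
  have hG := gain_nonneg hP h
  set G := gain P h with hGd
  set X := Matrix.vecMulVec (star h) h with hX
  have hS : (P : ℂ) * (h ⬝ᵥ star h) = G := by
    rw [← ofReal_sum_norm_sq, hGd, gain]; push_cast; rfl
  have hXX : (P : ℂ) • (X * X) = (G : ℂ) • X := by
    rw [hX, Matrix.vecMulVec_mul_vecMulVec, ← hS, Matrix.vecMulVec_smul, smul_smul]
  -- `B Bᴴ` is the inverse of a rank-one perturbation of the identity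
  have hBB : B * Bᴴ = 1 - ((P / (1 + G) : ℝ) : ℂ) • X := by
    have h1 : (B * Bᴴ) * (1 + (P : ℂ) • X) = 1 := by
      rw [← hC, Matrix.mul_assoc, ← Matrix.mul_assoc Bᴴ, ← Matrix.conjTranspose_mul, hCB]
      simp [mul_eq_one_comm.mp hCB]
    have h2 : (1 + (P : ℂ) • X) * (1 - ((P / (1 + G) : ℝ) : ℂ) • X) = 1 := by
      have h3 : (1 + (G : ℂ)) ≠ 0 := by
        have : (1 + G : ℝ) ≠ 0 := by positivity
        exact_mod_cast this
      rw [Matrix.add_mul, Matrix.mul_sub, Matrix.mul_sub, Matrix.one_mul, Matrix.one_mul,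
        Matrix.mul_one, Matrix.smul_mul, Matrix.mul_smul, smul_comm, hXX]
      push_cast
      rw [smul_smul, sub_add_sub_comm, ← sub_eq_zero]
      have : ((P : ℂ) / (1 + G)) + (P / (1 + G)) * G = P := by field_simp
      rw [← sub_eq_zero] at this
      have h4 : (1 : Matrix (Fin L) (Fin L) ℂ) + (P : ℂ) • X - ((P / (1 + G) : ℂ) • X +
        ((P / (1 + G) : ℂ) * G) • X) - 1 = -((P / (1 + G) + P / (1 + G) * G - P : ℂ) • X) := by
        module
      rw [h4, this]
      simp
    calc B * Bᴴ = (B * Bᴴ) * ((1 + (P : ℂ) • X) * (1 - ((P / (1 + G) : ℝ) : ℂ) • X)) := by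
          rw [h2, Matrix.mul_one]
      _ = _ := by rw [← Matrix.mul_assoc, h1, Matrix.one_mul]
  have h5 : ((∑ l, ‖(y ᵥ* B) l‖ ^ 2 : ℝ) : ℂ) = ((∑ l, ‖y l‖ ^ 2 -
      P / (1 + G) * ‖∑ l, y l * star (h l)‖ ^ 2 : ℝ) : ℂ) := by
    rw [ofReal_sum_norm_sq, Matrix.star_vecMul, Matrix.dotProduct_mulVec, Matrix.vecMul_vecMul, hBB,
      Matrix.vecMul_sub, Matrix.vecMul_one, sub_dotProduct, Complex.ofReal_sub, ofReal_sum_norm_sq,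
      Matrix.vecMul_smul, hX, Matrix.vecMul_vecMulVec, smul_dotProduct, smul_dotProduct]
    congr 1
    rw [Complex.ofReal_mul, smul_eq_mul]
    congr 1
    have h6 : h ⬝ᵥ star y = star (y ⬝ᵥ star h) := by
      simp [dotProduct, mul_comm]
    change (y ⬝ᵥ star h) • (h ⬝ᵥ star y) = ((‖y ⬝ᵥ star h‖ ^ 2 : ℝ) : ℂ)
    rw [h6, smul_eq_mul, RCLike.star_def, Complex.mul_conj, Complex.normSq_eq_norm_sq]
  exact_mod_cast h5

/-- The information density of a single user depends on the output only through the coherent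
combination `∑ l, Y i l * conj (h l)` of the antennas. -/
lemma infoDensity_single {P : ℝ} (hP : 0 ≤ P) (h : Fin L → ℂ) {C B : Matrix (Fin L) (Fin L) ℂ}
    (hCB : C * B = 1) (hC : Cᴴ * C = 1 + (P : ℂ) • Matrix.vecMulVec (star h) h)
    (x : Fin N → ℂ) (Y : Fin N → Fin L → ℂ) :
    infoDensity B (fun i l => h l * x i) Y =
      N * Real.log (1 + gain P h) -
        P / (1 + gain P h) * ∑ i, ‖∑ l, Y i l * star (h l)‖ ^ 2 +
        2 * (∑ i, (∑ l, Y i l * star (h l)) * star (x i)).re -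
        (∑ l, ‖h l‖ ^ 2) * ∑ i, ‖x i‖ ^ 2 := by
  have hdet : ‖B.det‖ ^ 2 = (1 + gain P h)⁻¹ := by
    rw [(norm_det_inv_sq hCB hC).2]
    congr 1
    have h1 : (P : ℂ) • Matrix.vecMulVec (star h) h =
        Matrix.replicateCol Unit ((P : ℂ) • star h) * Matrix.replicateRow Unit h := by
      rw [← Matrix.vecMulVec_eq, Matrix.smul_vecMulVec]
    rw [h1, Matrix.det_one_add_replicateCol_mul_replicateRow, gain]
    simp only [dotProduct, Pi.smul_apply, Pi.star_apply, smul_eq_mul, Complex.add_re,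
      Complex.one_re, Complex.re_sum, Finset.mul_sum]
    congr 1
    refine Finset.sum_congr rfl fun l _ => ?_
    rw [mul_left_comm, RCLike.star_def, Complex.mul_conj, Complex.normSq_eq_norm_sq,
      ← Complex.ofReal_mul, Complex.ofReal_re]
  have hrow : ∀ i, ∑ l, ‖Y i l - h l * x i‖ ^ 2 = ∑ l, ‖Y i l‖ ^ 2 -
      2 * ((∑ l, Y i l * star (h l)) * star (x i)).re + (∑ l, ‖h l‖ ^ 2) * ‖x i‖ ^ 2 := by
    intro i
    rw [Finset.sum_mul, Finset.sum_mul, Complex.re_sum, Finset.mul_sum, ← Finset.sum_sub_distrib,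
      ← Finset.sum_add_distrib]
    refine Finset.sum_congr rfl fun l _ => ?_
    rw [← Complex.normSq_eq_norm_sq, Complex.normSq_sub, Complex.normSq_mul,
      Complex.normSq_eq_norm_sq, Complex.normSq_eq_norm_sq, Complex.normSq_eq_norm_sq, map_mul,
      mul_assoc]
    simp only [RCLike.star_def]
    ring
  unfold infoDensity
  simp_rw [whitened_norm_sq hP h hCB hC, hrow, hdet, Real.log_inv]
  rw [Finset.sum_sub_distrib, Finset.sum_add_distrib, Finset.sum_sub_distrib, ← Finset.mul_sum,
    ← Finset.mul_sum, ← Finset.mul_sum, Complex.re_sum]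
  ring

lemma sum_norm_sq_affine (z : Fin N → ℂ) (g q : ℝ) :
    ∑ i, ‖(g : ℂ) * z i - (q : ℂ)‖ ^ 2 =
      g ^ 2 * ∑ i, ‖z i‖ ^ 2 - 2 * (g * q) * (∑ i, z i).re + N * q ^ 2 := by
  have : ∀ i, ‖(g : ℂ) * z i - (q : ℂ)‖ ^ 2 = g ^ 2 * ‖z i‖ ^ 2 - 2 * (g * q) * (z i).re + q ^ 2 := by
    intro i
    rw [← Complex.normSq_eq_norm_sq, ← Complex.normSq_eq_norm_sq]
    simp [Complex.normSq_apply]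
    ring
  simp_rw [this]
  rw [Finset.sum_add_distrib, Finset.sum_sub_distrib, ← Finset.mul_sum, ← Finset.mul_sum,
    Complex.re_sum]
  simp

/-- After combining the antennas and rotating the codeword to a constant one, an event for the
Gaussian matrix becomes an event for a Gaussian vector. -/
lemma gaussianMatrix_real_combine (a : Fin L → ℂ) (U : Matrix (Fin N) (Fin N) ℂ) (hU : U * Uᴴ = 1)
    {S : Set (Fin N → ℂ)} (hS : MeasurableSet S) :
    (gaussianMatrix N L).real {Z | (fun i => ∑ l, Z i l * a l) ∈ S} =
      (gaussianVector N).real {w | (fun i => ((Real.sqrt (∑ l, ‖a l‖ ^ 2) : ℝ) : ℂ) *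
        (w ᵥ* Uᴴ) i) ∈ S} := by
  have hm1 : Measurable fun (Z : Fin N → Fin L → ℂ) i => ∑ l, Z i l * a l := by fun_prop
  have hm2 : Measurable fun (z : Fin N → ℂ) i => ((Real.sqrt (∑ l, ‖a l‖ ^ 2) : ℝ) : ℂ) * z i := by
    fun_prop
  have hU' : Uᴴ * Uᴴᴴ = 1 := by rw [Matrix.conjTranspose_conjTranspose]; exact mul_eq_one_comm.mp hU
  have h1 : (gaussianMatrix N L).real {Z | (fun i => ∑ l, Z i l * a l) ∈ S} =
      ((gaussianMatrix N L).map fun Z i => ∑ l, Z i l * a l).real S :=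
    (map_measureReal_apply hm1 hS).symm
  rw [h1, gaussianMatrix_map_dotProduct, map_measureReal_apply hm2 hS,
    ← gaussianVector_map_unitary Uᴴ hU', map_measureReal_apply (measurable_vecMul _) (hm2 hS),
    gaussianVector_map_unitary Uᴴ hU']
  rfl

lemma rotated_inner (x w : Fin N → ℂ) (U : Matrix (Fin N) (Fin N) ℂ) {P : ℝ}
    (hx : x ᵥ* U = fun _ => ((Real.sqrt P : ℝ) : ℂ)) :
    ∑ i, (w ᵥ* Uᴴ) i * star (x i) = (Real.sqrt P : ℝ) * ∑ i, w i := by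
  change (w ᵥ* Uᴴ) ⬝ᵥ star x = _
  rw [← Matrix.dotProduct_mulVec, ← Matrix.star_vecMul, hx]
  simp [dotProduct, Finset.sum_mul, mul_comm]

/-- Law of the information density for a codeword of energy exactly `N P`, under both output
laws. -/
lemma infoDensity_single_law {P : ℝ} (hP : 0 ≤ P) (h : Fin L → ℂ)
    {C B : Matrix (Fin L) (Fin L) ℂ} (hCB : C * B = 1)
    (hC : Cᴴ * C = 1 + (P : ℂ) • Matrix.vecMulVec (star h) h)
    (x : Fin N → ℂ) (hx : ∑ i, ‖x i‖ ^ 2 = N * P) (γ : ℝ) :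
    (gaussianMatrix N L).real {Z | γ < infoDensity B (fun i l => h l * x i)
        ((fun i l => h l * x i) + Z)} =
      (gaussianVector N).real {z | γ < densityTrue P (h, z)} ∧
    (gaussianMatrix N L).real {Z | γ < infoDensity B (fun i l => h l * x i) fun i => Z i ᵥ* C} =
      (gaussianVector N).real {z | γ < densityAux P (h, z)} := by
  -- rotate the codeword to the constant vector with entries `√P`
  obtain ⟨U, hU, hxU⟩ := exists_unitary_vecMul_eq x (fun _ => ((Real.sqrt P : ℝ) : ℂ)) (by
    rw [hx]; simp [sq_abs, Real.sq_sqrt hP])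
  have hG0 := gain_nonneg hP h
  have hU' : Uᴴ * Uᴴᴴ = 1 := by rw [Matrix.conjTranspose_conjTranspose]; exact mul_eq_one_comm.mp hU
  have hS0 : 0 ≤ ∑ l, ‖h l‖ ^ 2 := by positivity
  have hGS : gain P h = P * ∑ l, ‖h l‖ ^ 2 := rfl
  have hsG : Real.sqrt (gain P h) = Real.sqrt P * Real.sqrt (∑ l, ‖h l‖ ^ 2) := by
    rw [hGS, Real.sqrt_mul hP]
  set S2 := ∑ l, ‖h l‖ ^ 2 with hS2
  set G := gain P h with hG
  have hp := Real.sq_sqrt hP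
  have hs := Real.sq_sqrt hS0
  have hq := Real.sq_sqrt (show 0 ≤ 1 + G by positivity)
  set p := Real.sqrt P with hpd
  set ρ := Real.sqrt S2 with hρ
  set q := Real.sqrt (1 + G) with hqd
  have h1G : 1 + G ≠ 0 := by positivity
  constructor
  -- channel law: the combined output is `‖h‖² x i` plus Gaussian noise of standard deviation `‖h‖`
  · have hr : ∀ (Z : Fin N → Fin L → ℂ) i, ∑ l, ((fun i l => h l * x i) + Z) i l * star (h l) =
        S2 * x i + ∑ l, Z i l * star (h l) := by
      intro Z i
      simp only [Pi.add_apply, add_mul, Finset.sum_add_distrib]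
      congr 1
      rw [hS2, Complex.ofReal_sum, Finset.sum_mul]
      refine Finset.sum_congr rfl fun l _ => ?_
      rw [mul_right_comm, RCLike.star_def, Complex.mul_conj, Complex.normSq_eq_norm_sq]
    have hset : MeasurableSet {r : Fin N → ℂ | γ < N * Real.log (1 + G) -
        P / (1 + G) * ∑ i, ‖S2 * x i + r i‖ ^ 2 +
        2 * (∑ i, (S2 * x i + r i) * star (x i)).re - S2 * ∑ i, ‖x i‖ ^ 2} := by
      refine measurableSet_lt measurable_const ?_
      have : Measurable fun r : Fin N → ℂ => (∑ i, (S2 * x i + r i) * star (x i)).re :=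
        Complex.measurable_re.comp (by fun_prop)
      fun_prop
    have h2 := gaussianMatrix_real_combine (fun l => star (h l)) U hU hset
    simp only [Set.mem_ofPred_eq, norm_star, ← hS2, ← hρ] at h2
    simp_rw [infoDensity_single hP h hCB hC, hr, ← hS2, ← hG]
    rw [h2]
    congr 1
    ext w
    have hin := rotated_inner x w U hxU
    have hnw := unitary_norm_sq Uᴴ hU' w
    have e1 : ∑ i, (S2 * x i + (ρ : ℂ) * (w ᵥ* Uᴴ) i) * star (x i) =
        ((S2 * (N * P) : ℝ) : ℂ) + ((ρ * p : ℝ) : ℂ) * ∑ i, w i := by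
      simp_rw [add_mul, mul_assoc]
      rw [Finset.sum_add_distrib, ← Finset.mul_sum, ← Finset.mul_sum, hin, ← hx]
      push_cast
      simp_rw [RCLike.star_def, Complex.mul_conj, Complex.normSq_eq_norm_sq]
      push_cast
      ring
    have e2 : ∑ i, ‖S2 * x i + (ρ : ℂ) * (w ᵥ* Uᴴ) i‖ ^ 2 =
        S2 ^ 2 * (N * P) + 2 * (S2 * ρ * p) * (∑ i, w i).re + S2 * ∑ i, ‖w i‖ ^ 2 := by
      have e3 : ∀ i, ‖S2 * x i + (ρ : ℂ) * (w ᵥ* Uᴴ) i‖ ^ 2 = S2 ^ 2 * ‖x i‖ ^ 2 +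
          2 * (S2 * ρ) * ((w ᵥ* Uᴴ) i * star (x i)).re + S2 * ‖(w ᵥ* Uᴴ) i‖ ^ 2 := by
        intro i
        rw [← Complex.normSq_eq_norm_sq, ← Complex.normSq_eq_norm_sq,
          ← Complex.normSq_eq_norm_sq]
        simp only [Complex.normSq_apply, Complex.add_re, Complex.add_im, Complex.mul_re,
          Complex.mul_im, Complex.ofReal_re, Complex.ofReal_im, RCLike.star_def, Complex.conj_re, Complex.conj_im]
        linear_combination (((w ᵥ* Uᴴ) i).re ^ 2 + ((w ᵥ* Uᴴ) i).im ^ 2) * hs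
      simp_rw [e3]
      rw [Finset.sum_add_distrib, Finset.sum_add_distrib, ← Finset.mul_sum, ← Finset.mul_sum,
        ← Finset.mul_sum, ← Complex.re_sum, hin, hnw, hx, Complex.re_ofReal_mul]
      ring
    have e4 : densityTrue P (h, w) = N * Real.log (1 + G) + N -
        (G * ∑ i, ‖w i‖ ^ 2 - 2 * (ρ * p) * (∑ i, w i).re + N) / (1 + G) := by
      have h5 := sum_norm_sq_affine w (Real.sqrt G) 1
      rw [Complex.ofReal_one, Real.sq_sqrt hG0] at h5
      simp only [densityTrue, ← hG]
      rw [Finset.sum_sub_distrib, ← Finset.sum_div, h5, hsG]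
      simp only [Finset.sum_const, Finset.card_univ, Fintype.card_fin, nsmul_eq_mul]
      ring
    simp only [Set.mem_ofPred_eq]
    rw [e1, e2, e4, hx, Complex.add_re, Complex.ofReal_re, Complex.re_ofReal_mul]
    have e5 : (N : ℝ) * Real.log (1 + G) - P / (1 + G) * (S2 ^ 2 * (N * P) +
        2 * (S2 * ρ * p) * (∑ i, w i).re + S2 * ∑ i, ‖w i‖ ^ 2) +
        2 * (S2 * (N * P) + ρ * p * (∑ i, w i).re) - S2 * (N * P) =
        N * Real.log (1 + G) + N -
        (G * ∑ i, ‖w i‖ ^ 2 - 2 * (ρ * p) * (∑ i, w i).re + N) / (1 + G) := by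
      field_simp
      rw [hGS]
      ring
    rw [e5]
  -- auxiliary law: the combined output is Gaussian with standard deviation `‖h‖ √(1 + G)`
  · have hr : ∀ (Z : Fin N → Fin L → ℂ) i, ∑ l, (Z i ᵥ* C) l * star (h l) =
        ∑ l, Z i l * (C *ᵥ star h) l := fun Z i => (Matrix.dotProduct_mulVec (Z i) C (star h)).symm
    have hnorm : ∑ l, ‖(C *ᵥ star h) l‖ ^ 2 = S2 * (1 + G) := by
      have key : ∀ v : Fin L → ℂ, ((∑ i, ‖v i‖ ^ 2 : ℝ) : ℂ) = star v ⬝ᵥ v := by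
        intro v
        simp [dotProduct, ← Complex.normSq_eq_conj_mul_self, Complex.normSq_eq_norm_sq]
      have : ((∑ l, ‖(C *ᵥ star h) l‖ ^ 2 : ℝ) : ℂ) = ((S2 * (1 + G) : ℝ) : ℂ) := by
        have hkh : star (star h) ⬝ᵥ star h = (S2 : ℂ) := by
          rw [← key, hS2]; simp
        rw [star_star] at hkh
        rw [key, Matrix.star_mulVec, ← Matrix.dotProduct_mulVec, Matrix.mulVec_mulVec, hC,
          Matrix.add_mulVec, Matrix.one_mulVec, Matrix.smul_mulVec, Matrix.vecMulVec_mulVec,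
          dotProduct_add, star_star, dotProduct_smul, dotProduct_smul, hkh, hGS]
        simp
        ring
      exact_mod_cast this
    have hset : MeasurableSet {r : Fin N → ℂ | γ < N * Real.log (1 + G) -
        P / (1 + G) * ∑ i, ‖r i‖ ^ 2 + 2 * (∑ i, r i * star (x i)).re - S2 * ∑ i, ‖x i‖ ^ 2} := by
      refine measurableSet_lt measurable_const ?_
      have : Measurable fun r : Fin N → ℂ => (∑ i, r i * star (x i)).re :=
        Complex.measurable_re.comp (by fun_prop)
      fun_prop
    have h2 := gaussianMatrix_real_combine (C *ᵥ star h) U hU hset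
    have hsq : Real.sqrt (S2 * (1 + G)) = ρ * q := Real.sqrt_mul hS0 _
    simp only [Set.mem_ofPred_eq, hnorm, hsq] at h2
    simp_rw [infoDensity_single hP h hCB hC, hr, ← hS2, ← hG]
    rw [h2]
    congr 1
    ext w
    have hin := rotated_inner x w U hxU
    have hnw := unitary_norm_sq Uᴴ hU' w
    have e1 : ∑ i, ((ρ * q : ℝ) : ℂ) * (w ᵥ* Uᴴ) i * star (x i) =
        ((ρ * q * p : ℝ) : ℂ) * ∑ i, w i := by
      simp_rw [mul_assoc]
      rw [← Finset.mul_sum, hin]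
      push_cast
      ring
    have e2 : ∑ i, ‖((ρ * q : ℝ) : ℂ) * (w ᵥ* Uᴴ) i‖ ^ 2 = S2 * (1 + G) * ∑ i, ‖w i‖ ^ 2 := by
      simp_rw [norm_mul, mul_pow, Complex.norm_real, Real.norm_eq_abs, sq_abs]
      rw [← Finset.mul_sum, hnw, mul_pow, hs, hq]
    have e4 : densityAux P (h, w) = N * Real.log (1 + G) + N -
        (G * ∑ i, ‖w i‖ ^ 2 - 2 * (ρ * p * q) * (∑ i, w i).re + N * (1 + G)) := by
      have h5 := sum_norm_sq_affine w (Real.sqrt G) q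
      rw [Real.sq_sqrt hG0, hq] at h5
      simp only [densityAux, ← hG]
      rw [Finset.sum_sub_distrib, ← hqd, h5, hsG]
      simp only [Finset.sum_const, Finset.card_univ, Fintype.card_fin, nsmul_eq_mul]
      ring
    simp only [Set.mem_ofPred_eq]
    rw [e1, e2, e4, hx, Complex.re_ofReal_mul]
    have e5 : (N : ℝ) * Real.log (1 + G) - P / (1 + G) * (S2 * (1 + G) * ∑ i, ‖w i‖ ^ 2) +
        2 * (ρ * q * p * (∑ i, w i).re) - S2 * (N * P) =
        N * Real.log (1 + G) + N -
        (G * ∑ i, ‖w i‖ ^ 2 - 2 * (ρ * p * q) * (∑ i, w i).re + N * (1 + G)) := by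
      field_simp
      rw [hGS]
      ring
    rw [e5]

end SingleUser

/-! ### The meta-converse for a fixed fading vector -/

/-- The best test between a codeword and the auxiliary output law, for a fixed fading vector `h`.
One extra symbol is appended to bring the energy of the codeword to `(n + 1) P`; the test ignores
it. -/
lemma single_user_test {n L : ℕ} {P : ℝ} (hP : 0 ≤ P) (h : Fin L → ℂ)
    {C B : Matrix (Fin L) (Fin L) ℂ} (hCB : C * B = 1)
    (hC : Cᴴ * C = 1 + (P : ℂ) • Matrix.vecMulVec (star h) h)
    (x : Fin n → ℂ) (hx : ∑ i, ‖x i‖ ^ 2 ≤ n * P) (γ : ℝ)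
    {D : Set (Fin n → Fin L → ℂ)} (hD : MeasurableSet D) :
    (gaussianMatrix n L).real {Z | (fun i l => h l * x i) + Z ∈ D} ≤
      Real.exp γ * (gaussianMatrix n L).real {Z | (fun i => Z i ᵥ* C) ∈ D} +
      ((gaussianVector (n + 1)).real {z | γ < densityTrue P (h, z)} -
        Real.exp γ * (gaussianVector (n + 1)).real {z | γ < densityAux P (h, z)}) := by
  set r := Real.sqrt ((n + 1) * P - ∑ i, ‖x i‖ ^ 2) with hr
  have hr2 : r ^ 2 = (n + 1) * P - ∑ i, ‖x i‖ ^ 2 := Real.sq_sqrt (by linarith)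
  let x' : Fin (n + 1) → ℂ := Fin.snoc (α := fun _ => ℂ) x (r : ℂ)
  have hx' : ∑ i, ‖x' i‖ ^ 2 = ((n + 1 : ℕ) : ℝ) * P := by
    rw [Fin.sum_univ_castSucc]
    simp only [x', Fin.snoc_castSucc, Fin.snoc_last, Complex.norm_real, Real.norm_eq_abs, sq_abs]
    rw [hr2]
    push_cast
    ring
  have hm : Measurable fun (Y : Fin (n + 1) → Fin L → ℂ) (i : Fin n) => Y i.castSucc := by fun_prop
  have hmap := gaussianMatrix_map_comp (L := L) (Fin.castSucc_injective n)
  have hnp := neyman_pearson C B hCB (fun i l => h l * x' i) γ (hm hD)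
  obtain ⟨h1, h2⟩ := infoDensity_single_law hP h hCB hC x' hx' γ
  rw [h1, h2] at hnp
  have e1 : (gaussianMatrix (n + 1) L).real {Z | (fun i l => h l * x' i) + Z ∈
      (fun (Y : Fin (n + 1) → Fin L → ℂ) (i : Fin n) => Y i.castSucc) ⁻¹' D} =
      (gaussianMatrix n L).real {Z | (fun i l => h l * x i) + Z ∈ D} := by
    have hs : MeasurableSet {Z : Fin n → Fin L → ℂ | (fun i l => h l * x i) + Z ∈ D} :=
      measurable_const_add _ hD
    rw [← hmap, map_measureReal_apply hm hs]
    congr 1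
    ext Z
    simp only [Set.mem_ofPred_eq, Set.mem_preimage]
    have : (fun i : Fin n => ((fun (i : Fin (n + 1)) l => h l * x' i) + Z) i.castSucc) =
        (fun i l => h l * x i) + fun i : Fin n => Z i.castSucc := by
      funext i l
      simp [x']
    rw [this]
  have e2 : (gaussianMatrix (n + 1) L).real {Z | (fun i => Z i ᵥ* C) ∈
      (fun (Y : Fin (n + 1) → Fin L → ℂ) (i : Fin n) => Y i.castSucc) ⁻¹' D} =
      (gaussianMatrix n L).real {Z | (fun i => Z i ᵥ* C) ∈ D} := by
    have hs : MeasurableSet {Z : Fin n → Fin L → ℂ | (fun i => Z i ᵥ* C) ∈ D} :=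
      measurable_rows_vecMul C hD
    rw [← hmap, map_measureReal_apply hm hs]
    rfl
  rw [e1, e2] at hnp
  linarith

/-- Meta-converse for a fixed fading vector: under the auxiliary law the decoder is right for a
total of at most one message. -/
lemma single_user_bound {M n L : ℕ} {P : ℝ} (hP : 0 ≤ P) (h : Fin L → ℂ)
    (x : Fin M → Fin n → ℂ) (hx : ∀ m, ∑ i, ‖x m i‖ ^ 2 ≤ n * P) (γ : ℝ)
    (d : (Fin n → Fin L → ℂ) → Option (Fin M)) (hd : ∀ m, MeasurableSet {y | d y = some m}) :
    ∑ m, (gaussianMatrix n L).real {Z | d ((fun i l => h l * x m i) + Z) = some m} ≤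
      Real.exp γ + M * ((gaussianVector (n + 1)).real {z | γ < densityTrue P (h, z)} -
        Real.exp γ * (gaussianVector (n + 1)).real {z | γ < densityAux P (h, z)}) := by
  obtain ⟨C, B, hCB, hC⟩ := by
    open scoped ComplexOrder in
    exact exists_covariance_factor (Matrix.vecMulVec (star h) h)
      (Matrix.posSemidef_vecMulVec_star_self h) hP
  have h1 := Finset.sum_le_sum fun m (_ : m ∈ Finset.univ) =>
    single_user_test hP h hCB hC (x m) (hx m) γ (hd m)
  refine h1.trans ?_
  rw [Finset.sum_add_distrib, ← Finset.mul_sum, Finset.sum_const, Finset.card_univ,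
    Fintype.card_fin, nsmul_eq_mul]
  refine add_le_add ?_ le_rfl
  refine mul_le_of_le_one_right (Real.exp_pos γ).le ?_
  have hm : ∀ m, MeasurableSet {Z : Fin n → Fin L → ℂ | d (fun i => Z i ᵥ* C) = some m} := fun m =>
    measurable_rows_vecMul C (hd m)
  have hdisj : (↑(Finset.univ : Finset (Fin M)) : Set (Fin M)).PairwiseDisjoint
      fun m => {Z : Fin n → Fin L → ℂ | d (fun i => Z i ᵥ* C) = some m} := by
    intro m _ m' _ hne
    rw [Function.onFun, Set.disjoint_left]
    intro Z h1 h2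
    simp only [Set.mem_ofPred_eq] at h1 h2
    rw [h1] at h2
    exact hne (Option.some.inj h2)
  have h2 := measureReal_biUnion_finset (μ := gaussianMatrix n L) hdisj fun m _ => hm m
  have h3 : ∀ m, (gaussianMatrix n L).real {Z | (fun i => Z i ᵥ* C) ∈ {y | d y = some m}} =
    (gaussianMatrix n L).real {Z | d (fun i => Z i ᵥ* C) = some m} := fun m => rfl
  simp_rw [h3]
  rw [← h2]
  exact measureReal_le_one

/-- Circles are null sets for the complex Gaussian law. -/
lemma complexGaussian_sphere_eq_zero {g : ℝ} (hg : 0 < g) (q c : ℝ) :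
    complexGaussian {z : ℂ | ‖(g : ℂ) * z - (q : ℂ)‖ ^ 2 = c} = 0 := by
  have hac : complexGaussian ≪ volume := by
    rw [complexGaussian_eq_withDensity]
    exact withDensity_absolutelyContinuous _ _
  refine hac (measure_mono_null (t := Metric.sphere ((q / g : ℝ) : ℂ) (Real.sqrt c / g)) ?_
    (Measure.addHaar_sphere _ _ _))
  intro z hz
  simp only [Set.mem_ofPred_eq] at hz
  have h1 : (g : ℂ) * z - q = (g : ℂ) * (z - ((q / g : ℝ) : ℂ)) := by
    have : (g : ℂ) ≠ 0 := by exact_mod_cast hg.ne'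
    push_cast
    field_simp
  rw [h1, norm_mul, Complex.norm_real, Real.norm_of_nonneg hg.le] at hz
  rw [mem_sphere_iff_norm, eq_div_iff hg.ne', mul_comm, ← hz,
    Real.sqrt_sq (mul_nonneg hg.le (norm_nonneg _))]

/-- The information density under the auxiliary law has no atoms, because the fading vector does
not vanish almost surely. -/
lemma singleUserLaw_densityAux_eq_zero {n L : ℕ} {P : ℝ} (hP : 0 < P) (hL : 1 ≤ L) (γ : ℝ) :
    singleUserLaw L (n + 1) {ω | densityAux P ω = γ} = 0 := by
  unfold singleUserLaw
  rw [Measure.measure_prod_null (measurableSet_eq_fun (measurable_single_densityAux P)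
    measurable_const)]
  have hne : ∀ᵐ h ∂(gaussianVector L), h ⟨0, hL⟩ ≠ 0 := by
    have h1 : complexGaussian {z : ℂ | ‖((1 : ℝ) : ℂ) * z - ((0 : ℝ) : ℂ)‖ ^ 2 = 0} = 0 :=
      complexGaussian_sphere_eq_zero one_pos 0 0
    have h2 : {z : ℂ | ‖((1 : ℝ) : ℂ) * z - ((0 : ℝ) : ℂ)‖ ^ 2 = 0} = {0} := by
      ext z; simp
    rw [h2, ← gaussianVector_map_apply (⟨0, hL⟩ : Fin L),
      Measure.map_apply (measurable_pi_apply _) (measurableSet_singleton _)] at h1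
    simp only [ae_iff, ne_eq, not_not]
    exact h1
  filter_upwards [hne] with h hh
  have hG : 0 < gain P h := mul_pos hP (Finset.sum_pos' (fun l _ => by positivity)
    ⟨⟨0, hL⟩, Finset.mem_univ _, by have := norm_pos_iff.mpr hh; positivity⟩)
  have hg := Real.sqrt_pos.mpr hG
  have hm : MeasurableSet {z : Fin (n + 1) → ℂ | densityAux P (h, z) = γ} :=
    measurableSet_eq_fun ((measurable_single_densityAux P).comp measurable_prodMk_left)
      measurable_const
  have hp := (measurePreserving_piFinSuccAbove (fun _ : Fin (n + 1) => complexGaussian) 0).symm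
  change gaussianVector (n + 1) {z | densityAux P (h, z) = γ} = 0
  unfold gaussianVector
  rw [← hp.measure_preimage hm.nullMeasurableSet, Measure.prod_apply_symm (hp.measurable hm)]
  rw [lintegral_eq_zero_iff (measurable_measure_prodMk_right (hp.measurable hm))]
  -- given the other noise symbols, the first one is confined to a circle
  refine ae_of_all _ fun w => ?_
  have hsub : (fun z : ℂ => (z, w)) ⁻¹' ((MeasurableEquiv.piFinSuccAbove
      (fun _ : Fin (n + 1) => ℂ) 0).symm ⁻¹' {z | densityAux P (h, z) = γ}) ⊆
      {z : ℂ | ‖(Real.sqrt (gain P h) : ℂ) * z - (Real.sqrt (1 + gain P h) : ℂ)‖ ^ 2 =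
        Real.log (1 + gain P h) + 1 + densityAux P (h, w) - γ} := by
    intro z hz
    simp only [Set.mem_preimage, Set.mem_ofPred_eq, densityAux, Fin.sum_univ_succ] at hz ⊢
    simp only [MeasurableEquiv.piFinSuccAbove_symm_apply, Fin.insertNthEquiv, Equiv.coe_fn_mk,
      Fin.insertNth_zero, Fin.cons_zero, Fin.cons_succ, cast_eq] at hz
    linarith
  exact measure_mono_null hsub (complexGaussian_sphere_eq_zero hg _ _)

/-! ### Success probabilities of a code given the fading -/

lemma measureReal_prod_eq_integral {X Y : Type*} [MeasurableSpace X] [MeasurableSpace Y]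
    (μ : Measure X) (ν : Measure Y) [IsProbabilityMeasure μ] [IsProbabilityMeasure ν]
    {S : Set (X × Y)} (hS : MeasurableSet S) :
    (μ.prod ν).real S = ∫ x, ν.real (Prod.mk x ⁻¹' S) ∂μ := by
  rw [measureReal_def, Measure.prod_apply hS, ← integral_toReal
    (measurable_measure_prodMk_left hS).aemeasurable (ae_of_all _ fun x => measure_lt_top _ _)]
  rfl

section Coding

variable {K Ka M n L : ℕ} {P : ℝ}

lemma Code.sum_norm_sq_le (c : Code K Ka M n L P) (k : Fin K) (m : Fin M) :
    ∑ i, ‖c.enc k m i‖ ^ 2 ≤ n * P := by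
  rw [← EuclideanSpace.norm_sq_eq]
  exact c.power_le k m

lemma Code.measurableSet_dec_eq (c : Code K Ka M n L P) (k : Fin K) (m : Fin M) :
    MeasurableSet {yh | c.dec yh k = some m} := by
  have : {yh | c.dec yh k = some m} = ⋃ u ∈ {u : Fin K → Option (Fin M) | u k = some m},
      c.dec ⁻¹' {u} := by
    ext yh
    simp
  rw [this]
  exact MeasurableSet.biUnion (Set.to_countable _) fun u _ => c.measurableSet_dec u

lemma Code.received_eq (c : Code K Ka M n L P) (A : Finset (Fin K)) (w : A → Fin M)
    (H : Fin K → Fin L → ℂ) (Z : Fin n → Fin L → ℂ) :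
    c.received A w H Z = (fun i l => ∑ k : A, H k l * c.enc k (w k) i) + Z := by
  funext i l
  simp only [Code.received, Pi.add_apply]
  congr 1
  have h1 : ∑ k, H k l * c.sent A w k i = ∑ k ∈ A, H k l * c.sent A w k i := by
    refine (Finset.sum_subset (Finset.subset_univ A) fun k _ hk => ?_).symm
    simp [Code.sent, hk]
  rw [h1, ← Finset.sum_coe_sort A]
  refine Finset.sum_congr rfl fun k _ => ?_
  simp [Code.sent]

lemma Code.measurable_received (c : Code K Ka M n L P) (A : Finset (Fin K)) (w : A → Fin M) :
    Measurable fun HZ : (Fin K → Fin L → ℂ) × (Fin n → Fin L → ℂ) =>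
      (c.received A w HZ.1 HZ.2, HZ.1) := by
  unfold Code.received
  fun_prop

/-- Probability, given the fading, that the message of user `k` is decoded correctly. -/
noncomputable def Code.successProb (c : Code K Ka M n L P) (A : Finset (Fin K)) (k : Fin K)
    (hk : k ∈ A) (H : Fin K → Fin L → ℂ) : ℝ :=
  ((M : ℝ) ^ A.card)⁻¹ * ∑ w : A → Fin M,
    (gaussianMatrix n L).real {Z | c.dec (c.received A w H Z, H) k = some (w ⟨k, hk⟩)}

lemma Code.integral_successProb (c : Code K Ka M n L P) (A : Finset (Fin K)) (hM : 0 < M)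
    (k : A) :
    Integrable (c.successProb A k k.2) (gaussianMatrix K L) ∧
    (channelLaw K M n L A).real
      {ω | c.dec (c.received A ω.1 ω.2.1 ω.2.2, ω.2.1) k ≠ some (ω.1 k)} =
      1 - ∫ H, c.successProb A k k.2 H ∂(gaussianMatrix K L) := by
  have : Nonempty (Fin M) := ⟨⟨0, hM⟩⟩
  let μ : Measure (A → Fin M) := Measure.pi fun _ : A => uniformOn (Set.univ : Set (Fin M))
  have hsing : ∀ w : A → Fin M, μ.real {w} = ((M : ℝ) ^ A.card)⁻¹ := by
    intro w
    simp only [μ, measureReal_def, Measure.pi_singleton]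
    simp [uniformOn_univ]
  have hSw : ∀ w : A → Fin M, MeasurableSet {HZ : (Fin K → Fin L → ℂ) × (Fin n → Fin L → ℂ) |
      c.dec (c.received A w HZ.1 HZ.2, HZ.1) k = some (w k)} := fun w =>
    c.measurable_received A w (c.measurableSet_dec_eq k (w k))
  have hS : MeasurableSet {ω : (A → Fin M) × (Fin K → Fin L → ℂ) × (Fin n → Fin L → ℂ) |
      c.dec (c.received A ω.1 ω.2.1 ω.2.2, ω.2.1) k = some (ω.1 k)} := by
    have : {ω : (A → Fin M) × (Fin K → Fin L → ℂ) × (Fin n → Fin L → ℂ) |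
        c.dec (c.received A ω.1 ω.2.1 ω.2.2, ω.2.1) k = some (ω.1 k)} = ⋃ w : A → Fin M,
        {w} ×ˢ {HZ | c.dec (c.received A w HZ.1 HZ.2, HZ.1) k = some (w k)} := by
      ext ⟨w, H, Z⟩
      simp
    rw [this]
    exact MeasurableSet.iUnion fun w => (measurableSet_singleton w).prod (hSw w)
  have hint : ∀ w : A → Fin M, Integrable (fun H => (gaussianMatrix n L).real
      {Z | c.dec (c.received A w H Z, H) k = some (w k)}) (gaussianMatrix K L) := fun w =>
    Measure.integrable_measure_prodMk_left (hSw w) (measure_ne_top _ _)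
  constructor
  · exact (integrable_finsetSum _ fun w _ => hint w).const_mul _
  · have h1 : {ω : (A → Fin M) × (Fin K → Fin L → ℂ) × (Fin n → Fin L → ℂ) |
        c.dec (c.received A ω.1 ω.2.1 ω.2.2, ω.2.1) k ≠ some (ω.1 k)} =
        {ω | c.dec (c.received A ω.1 ω.2.1 ω.2.2, ω.2.1) k = some (ω.1 k)}ᶜ := rfl
    have h2 : channelLaw K M n L A = μ.prod ((gaussianMatrix K L).prod (gaussianMatrix n L)) := rfl
    rw [h1, h2, probReal_compl_eq_one_sub hS, measureReal_prod_eq_integral _ _ hS,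
      integral_fintype .of_finite]
    congr 1
    simp only [Code.successProb]
    rw [integral_const_mul, integral_finsetSum _ fun w _ => hint w, Finset.mul_sum]
    refine Finset.sum_congr rfl fun w _ => ?_
    rw [hsing, smul_eq_mul]
    congr 1
    exact measureReal_prod_eq_integral _ _ (hSw w)

/-- Fano-type inequality for a set `T` of active users, given the fading and with the messages of
the other users revealed to the receiver. -/
lemma Code.fano_successProb (c : Code K Ka M n L P) (A : Finset (Fin K)) (hM : 0 < M)
    (hP : 0 ≤ P) {a : ℝ} (ha : 0 ≤ a) (T : Finset A) {t : ℕ} (e : Fin t ≃ T)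
    (H : Fin K → Fin L → ℂ) :
    a * ∑ k ∈ T, c.successProb A k k.2 H ≤
      n * Real.log (1 + (P : ℂ) • ((Matrix.of fun i => H (e i).1)ᴴ *
        Matrix.of fun i => H (e i).1)).det.re + t * Real.log (1 + (Real.exp a - 1) / M) := by
  let E := Equiv.piEquivPiSubtypeProd (fun j : A => j ∈ T) (fun _ : A => Fin M)
  let HT : Matrix {j : A // j ∈ T} (Fin L) ℂ := fun j => H j.1
  -- the contribution of the users whose messages are revealed
  let V : ({j : A // ¬ j ∈ T} → Fin M) → Fin n → Fin L → ℂ := fun v i l =>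
    ∑ j : {j : A // ¬ j ∈ T}, H j.1 l * c.enc j.1 (v j) i
  have hrec : ∀ s v Z, c.received A (E.symm (s, v)) H Z =
      superposition HT (fun j m i => c.enc j.1 m i) s + Z + V v := by
    intro s v Z
    rw [Code.received_eq, add_right_comm]
    congr 1
    funext i l
    rw [← Fintype.sum_subtype_add_sum_subtype (fun j : A => j ∈ T)]
    simp only [Pi.add_apply, superposition, V, HT]
    congr 1
    · refine Finset.sum_congr (by ext; simp) fun j _ => ?_
      simp [E, Equiv.piEquivPiSubtypeProd, j.2]
    · refine Finset.sum_congr rfl fun j _ => ?_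
      simp [E, Equiv.piEquivPiSubtypeProd, j.2]
  have hdet : (1 + (P : ℂ) • (HTᴴ * HT)).det.re = (1 + (P : ℂ) •
      ((Matrix.of fun i => H (e i).1)ᴴ * Matrix.of fun i => H (e i).1)).det.re := by
    have h1 : (Matrix.of fun i => H (e i).1) = HT.submatrix e id := rfl
    have h2 : (HT.submatrix e id)ᴴ * HT.submatrix e id = HTᴴ * HT := by
      rw [Matrix.conjTranspose_submatrix, Matrix.submatrix_mul_equiv, Matrix.submatrix_id_id]
    rw [h1, h2]
  have hcardT : Fintype.card {j : A // j ∈ T} = t := by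
    rw [← Fintype.card_congr e, Fintype.card_fin]
  rw [← hdet, ← hcardT]
  set R := n * Real.log (1 + (P : ℂ) • (HTᴴ * HT)).det.re +
    Fintype.card {j : A // j ∈ T} * Real.log (1 + (Real.exp a - 1) / M) with hR
  have hv : ∀ v : {j : A // ¬ j ∈ T} → Fin M, a * ∑ s : {j : A // j ∈ T} → Fin M,
      ∑ k : {j : A // j ∈ T}, (gaussianMatrix n L).real
        {Z | c.dec (c.received A (E.symm (s, v)) H Z, H) k.1 = some (E.symm (s, v) k.1)} ≤
      (M : ℝ) ^ Fintype.card {j : A // j ∈ T} * R := by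
    intro v
    have h := fano_fixed_channel HT hP ha hM (fun j m i => c.enc j.1 m i)
      (fun j m => c.sum_norm_sq_le j.1 m) (fun j y => c.dec (y + V v, H) j.1) (fun j m => by
        have hm : Measurable fun y : Fin n → Fin L → ℂ => (y + V v, H) := by fun_prop
        exact hm (c.measurableSet_dec_eq j.1 m))
    refine le_trans (le_of_eq ?_) h
    congr 1
    refine Finset.sum_congr rfl fun s _ => Finset.sum_congr rfl fun k _ => ?_
    have hk : E.symm (s, v) k.1 = s k := by simp [E, Equiv.piEquivPiSubtypeProd, k.2]
    rw [hk]
    simp_rw [hrec]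
  have hsum := Finset.sum_le_sum fun v (_ : v ∈ Finset.univ) => hv v
  rw [← Finset.mul_sum, Finset.sum_const, Finset.card_univ, nsmul_eq_mul, ← mul_assoc] at hsum
  have hcard : ((Fintype.card ({j : A // ¬ j ∈ T} → Fin M) : ℕ) : ℝ) *
      (M : ℝ) ^ Fintype.card {j : A // j ∈ T} = (M : ℝ) ^ A.card := by
    have h1 := Fintype.card_congr E
    rw [Fintype.card_prod] at h1
    have h2 : Fintype.card (A → Fin M) = M ^ A.card := by simp
    have h3 : Fintype.card ({j : A // j ∈ T} → Fin M) = M ^ Fintype.card {j : A // j ∈ T} := by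
      simp
    rw [h2, h3, mul_comm] at h1
    exact_mod_cast h1.symm
  rw [hcard] at hsum
  have hM' : (0 : ℝ) < M := by exact_mod_cast hM
  have htot : ∑ k ∈ T, c.successProb A k k.2 H = ((M : ℝ) ^ A.card)⁻¹ *
      ∑ v : {j : A // ¬ j ∈ T} → Fin M, ∑ s : {j : A // j ∈ T} → Fin M,
      ∑ k : {j : A // j ∈ T}, (gaussianMatrix n L).real
        {Z | c.dec (c.received A (E.symm (s, v)) H Z, H) k.1 = some (E.symm (s, v) k.1)} := by
    simp only [Code.successProb]
    rw [← Finset.mul_sum, Finset.sum_comm, ← E.symm.sum_comp, Fintype.sum_prod_type_right]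
    congr 1
    refine Finset.sum_congr rfl fun v _ => Finset.sum_congr rfl fun s _ => ?_
    exact (Finset.sum_coe_sort T fun k => (gaussianMatrix n L).real
        {Z | c.dec (c.received A (E.symm (s, v)) H Z, H) k = some (E.symm (s, v) k)}).symm
  rw [htot, mul_left_comm, inv_mul_le_iff₀ (by positivity)]
  exact hsum

/-- Meta-converse for one user, given the fading and the messages of the other users. -/
lemma Code.meta_successProb (c : Code K Ka M n L P) (A : Finset (Fin K)) (hM : 0 < M)
    (hP : 0 ≤ P) (γ : ℝ) (k : A) (H : Fin K → Fin L → ℂ) :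
    c.successProb A k k.2 H ≤ Real.exp γ / M +
      ((gaussianVector (n + 1)).real {z | γ < densityTrue P (H k, z)} -
        Real.exp γ * (gaussianVector (n + 1)).real {z | γ < densityAux P (H k, z)}) := by
  have hM' : (0 : ℝ) < M := by exact_mod_cast hM
  set R := (gaussianVector (n + 1)).real {z | γ < densityTrue P (H k, z)} -
        Real.exp γ * (gaussianVector (n + 1)).real {z | γ < densityAux P (H k, z)} with hR
  have hw : ∀ w : A → Fin M, ∑ m, (gaussianMatrix n L).real
      {Z | c.dec (c.received A (Function.update w k m) H Z, H) k =
        some (Function.update w k m k)} ≤ Real.exp γ + M * R := by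
    intro w
    -- the interference of the other users
    let V : Fin n → Fin L → ℂ := fun i l =>
      ∑ j ∈ Finset.univ.erase k, H j l * c.enc j (w j) i
    have hrec : ∀ m Z, c.received A (Function.update w k m) H Z =
        (fun i l => H k l * c.enc k m i) + Z + V := by
      intro m Z
      rw [Code.received_eq, add_right_comm]
      congr 1
      funext i l
      rw [← Finset.add_sum_erase _ _ (Finset.mem_univ k)]
      simp only [Pi.add_apply, V, Function.update_self]
      congr 1
      refine Finset.sum_congr rfl fun j hj => ?_
      rw [Function.update_of_ne (Finset.ne_of_mem_erase hj)]
    have h := single_user_bound hP (H k) (fun m i => c.enc k m i)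
      (fun m => c.sum_norm_sq_le k m) γ (fun y => c.dec (y + V, H) k) (fun m => by
        have hm : Measurable fun y : Fin n → Fin L → ℂ => (y + V, H) := by fun_prop
        exact hm (c.measurableSet_dec_eq k m))
    simp_rw [hrec, Function.update_self]
    exact h
  have hsum := Finset.sum_le_sum fun w (_ : w ∈ Finset.univ) => hw w
  rw [← sum_resample k (fun w : A → Fin M => (gaussianMatrix n L).real
      {Z | c.dec (c.received A w H Z, H) k = some (w k)}), Finset.sum_const, Finset.card_univ,
    nsmul_eq_mul] at hsum
  have hcard : ((Fintype.card (A → Fin M) : ℕ) : ℝ) = (M : ℝ) ^ A.card := by simp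
  rw [hcard] at hsum
  simp only [Code.successProb]
  rw [inv_mul_le_iff₀ (by positivity)]
  refine le_of_mul_le_mul_left (hsum.trans_eq ?_) hM'
  field_simp

end Coding

/-! ### Converse bounds for achievable powers -/

/-- Optimisation over the tilting parameter `a`: the choice `exp a = M (1 - ε) / ε` turns the
tilted inequality into Fano's inequality. -/
lemma fano_of_tilted {κ t M ε I : ℝ} (ht : 0 ≤ t) (htκ : t ≤ κ) (hM : 1 ≤ M) (hε0 : 0 ≤ ε)
    (hε1 : ε ≤ 1) (hI : 0 ≤ I)
    (h : ∀ a, 0 ≤ a → a * (t - κ * ε) ≤ I + t * Real.log (1 + (Real.exp a - 1) / M)) :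
    (t - κ * ε) * Real.log M - κ * Real.binEntropy ε ≤ I := by
  have hM0 : 0 < M := one_pos.trans_le hM
  have hκ : 0 ≤ κ := ht.trans htκ
  have hlogM := Real.log_nonneg hM
  rcases hε0.eq_or_lt with rfl | hε
  · -- for `ε = 0` the optimal parameter is infinite
    simp only [mul_zero, sub_zero, Real.binEntropy_zero] at h ⊢
    have h1 : ∀ a, 0 ≤ a → t * Real.log M ≤ I + t * (M * Real.exp (-a)) := by
      intro a ha
      have h2 : 1 + (Real.exp a - 1) / M ≤ Real.exp a / M * (1 + M * Real.exp (-a)) := by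
        have : Real.exp a / M * (1 + M * Real.exp (-a)) = Real.exp a / M + 1 := by
          rw [mul_add, mul_one, div_mul_eq_mul_div, mul_left_comm, ← Real.exp_add]
          simp [hM0.ne']
        rw [this, sub_div]
        have : 0 < 1 / M := by positivity
        linarith
      have h3 : 0 < 1 + (Real.exp a - 1) / M := by
        have : 0 ≤ (Real.exp a - 1) / M := div_nonneg (by linarith [Real.add_one_le_exp a]) hM0.le
        linarith
      have h4 := Real.log_le_log h3 h2
      have h5 : 0 < 1 + M * Real.exp (-a) := by positivity
      rw [Real.log_mul (by positivity) h5.ne', Real.log_div (by positivity) hM0.ne',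
        Real.log_exp] at h4
      have h6 := Real.log_le_sub_one_of_pos h5
      have h7 := mul_le_mul_of_nonneg_left (h4.trans (add_le_add_right h6 _)) ht
      have h8 := h a ha
      nlinarith
    have hlim : Filter.Tendsto (fun a => I + t * (M * Real.exp (-a))) Filter.atTop
        (nhds (I + t * (M * 0))) :=
      (((Real.tendsto_exp_neg_atTop_nhds_zero).const_mul M).const_mul t).const_add I
    rw [mul_zero, mul_zero, add_zero] at hlim
    exact ge_of_tendsto hlim ((Filter.eventually_ge_atTop 0).mono fun a ha => h1 a ha)
  · rcases le_or_gt (ε * (M + 1)) M with hle | hgt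
    · have hε1' : 0 < 1 - ε := by
        by_contra hcon
        have : ε = 1 := le_antisymm hε1 (by linarith)
        rw [this] at hle
        linarith
      -- `ε ≤ M / (M + 1)` says that `a = log (M (1 - ε) / ε)` is nonnegative
      have hx : 0 < M * (1 - ε) / ε := by positivity
      have hx1 : 1 ≤ M * (1 - ε) / ε := by rw [le_div_iff₀ hε]; linarith
      have h1 := h (Real.log (M * (1 - ε) / ε)) (Real.log_nonneg hx1)
      rw [Real.exp_log hx] at h1
      have h2 : 1 + (M * (1 - ε) / ε - 1) / M ≤ ε⁻¹ := by
        have : 1 + (M * (1 - ε) / ε - 1) / M = ε⁻¹ - 1 / M := by field_simp; ring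
        rw [this]
        have : 0 < 1 / M := by positivity
        linarith
      have h3 : 0 < 1 + (M * (1 - ε) / ε - 1) / M := by
        have : 0 ≤ (M * (1 - ε) / ε - 1) / M := div_nonneg (by linarith) hM0.le
        linarith
      have h4 := Real.log_le_log h3 h2
      rw [Real.log_inv] at h4
      rw [Real.log_div (by positivity) hε.ne', Real.log_mul hM0.ne' hε1'.ne'] at h1
      have h5 := mul_le_mul_of_nonneg_left h4 ht
      have h6 : 0 ≤ -Real.log (1 - ε) := neg_nonneg.mpr (Real.log_nonpos hε1'.le (by linarith))
      have h7 := mul_le_mul_of_nonneg_right htκ h6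
      rw [Real.binEntropy, Real.log_inv, Real.log_inv]
      nlinarith
    · -- for `ε > M / (M + 1)` the left-hand side is not positive
      have h1 : (t - κ * ε) * Real.log M ≤ κ * (1 - ε) * Real.log M :=
        mul_le_mul_of_nonneg_right (by linarith) hlogM
      have h2 : (1 - ε) * Real.log M ≤ (1 - ε) * Real.log (1 - ε)⁻¹ := by
        rcases hε1.eq_or_lt with rfl | hlt
        · simp
        · have h3 : 0 < 1 - ε := by linarith
          refine mul_le_mul_of_nonneg_left (Real.log_le_log hM0 ?_) h3.le
          rw [← one_div, le_div_iff₀ h3]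
          linarith
      have h3 : 0 ≤ ε * Real.log ε⁻¹ :=
        mul_nonneg hε0 (Real.log_nonneg ((one_le_inv₀ hε).mpr hε1))
      have h4 := mul_le_mul_of_nonneg_left h2 hκ
      have h5 := mul_nonneg hκ h3
      rw [Real.binEntropy]
      nlinarith

lemma logDet_eq {t L : ℕ} (P : ℝ) (H : Fin t → Fin L → ℂ) : logDet P H =
    Real.log (1 + (P : ℂ) • ((Matrix.of H)ᴴ * Matrix.of H)).det.re / Real.log 2 := rfl

/-- The upper bounds on the ergodic sum capacity of `t` users. -/
lemma integrable_logDet_and_le {t L : ℕ} {P : ℝ} (hP : 0 ≤ P) :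
    Integrable (fun H : Fin t → Fin L → ℂ => logDet P H) (gaussianMatrix t L) ∧
      ∫ H, logDet P H ∂(gaussianMatrix t L) ≤
        min (L * Real.logb 2 (1 + P * t)) (t * Real.logb 2 (1 + P * L)) := by
  have h2 : 0 < Real.log 2 := Real.log_pos one_lt_two
  simp_rw [logDet_eq]
  refine ⟨(integrable_log_det hP).div_const _, ?_⟩
  have h := integral_log_det_le (t := t) (L := L) hP
  rw [integral_div]
  simp only [Real.logb, ← mul_div_assoc]
  rw [min_div_div_right h2.le]
  exact div_le_div_of_nonneg_right h h2.le

lemma FanoCondition.loose {Ka n L : ℕ} {J ε P : ℝ} (hP : 0 ≤ P)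
    (h : FanoCondition Ka n L J ε P) : LooseCondition Ka n L J ε P := fun t ht =>
  (h t ht).trans (mul_le_mul_of_nonneg_left (integrable_logDet_and_le hP).2 (by positivity))

section Converse

variable {K Ka M n L : ℕ} {P : ℝ}

lemma Code.pupe_eq (c : Code K Ka M n L P) (A : Finset (Fin K)) (hM : 0 < M) :
    c.pupe A = 1 / (A.card : ℝ) *
      ∑ k : A, (1 - ∫ H, c.successProb A k k.2 H ∂(gaussianMatrix K L)) := by
  unfold Code.pupe
  congr 1
  exact Finset.sum_congr rfl fun k _ => (c.integral_successProb A hM k).2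

lemma Code.error_nonneg (c : Code K Ka M n L P) (A : Finset (Fin K)) (hM : 0 < M) (k : A) :
    0 ≤ 1 - ∫ H, c.successProb A k k.2 H ∂(gaussianMatrix K L) := by
  rw [← (c.integral_successProb A hM k).2]
  exact measureReal_nonneg

/-- Tilted Fano inequality for any `t` of the active users, averaged over the fading. -/
lemma Code.tilted_fano (c : Code K Ka M n L P) (A : Finset (Fin K)) (hM : 0 < M) (hP : 0 ≤ P)
    {ε : ℝ} (hc : c.pupe A ≤ ε) (hA : 0 < A.card) {t : ℕ} (ht : t ≤ A.card) {a : ℝ}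
    (ha : 0 ≤ a) :
    a * (t - A.card * ε) ≤ n * (∫ H, Real.log (1 + (P : ℂ) •
        ((Matrix.of H)ᴴ * Matrix.of H)).det.re ∂(gaussianMatrix t L)) +
      t * Real.log (1 + (Real.exp a - 1) / M) := by
  have hA' : (0 : ℝ) < A.card := by exact_mod_cast hA
  obtain ⟨T, -, hT⟩ := Finset.exists_subset_card_eq (s := (Finset.univ : Finset A)) (n := t)
    (by simpa using ht)
  let e : Fin t ≃ T := (Fintype.equivFinOfCardEq (by simpa using hT)).symm
  let f : Fin t → Fin K := fun i => (e i).1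
  have hf : Function.Injective f := fun i j hij =>
    e.injective (Subtype.ext (Subtype.ext hij))
  set q : A → ℝ := fun k => ∫ H, c.successProb A k k.2 H ∂(gaussianMatrix K L) with hq
  have herr : ∑ k : A, (1 - q k) ≤ A.card * ε := by
    rw [c.pupe_eq A hM, one_div, inv_mul_le_iff₀ hA'] at hc
    exact hc
  have hTle : ∑ k ∈ T, (1 - q k) ≤ ∑ k : A, (1 - q k) :=
    Finset.sum_le_sum_of_subset_of_nonneg (Finset.subset_univ T) fun k _ _ => c.error_nonneg A hM k
  rw [Finset.sum_sub_distrib, Finset.sum_const, hT, nsmul_eq_mul, mul_one] at hTle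
  have h1 : a * (t - A.card * ε) ≤ a * ∑ k ∈ T, q k :=
    mul_le_mul_of_nonneg_left (by linarith) ha
  refine h1.trans ?_
  let Φ : (Fin t → Fin L → ℂ) → ℝ := fun H => Real.log (1 + (P : ℂ) •
    ((Matrix.of H)ᴴ * Matrix.of H)).det.re
  have hmap := gaussianMatrix_map_comp (L := L) hf
  have hfm : AEMeasurable (fun (H : Fin K → Fin L → ℂ) i => H (f i)) (gaussianMatrix K L) :=
    Measurable.aemeasurable (by fun_prop)
  have hΦi : Integrable Φ (gaussianMatrix t L) := integrable_log_det hP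
  have hΦi' : Integrable (fun H : Fin K → Fin L → ℂ => Φ fun i => H (f i)) (gaussianMatrix K L) := by
    rw [← hmap] at hΦi
    exact hΦi.comp_aemeasurable hfm
  have hΦe : ∫ H, Φ (fun i => H (f i)) ∂(gaussianMatrix K L) = ∫ H, Φ H ∂(gaussianMatrix t L) := by
    rw [← hmap] at hΦi ⊢
    exact (integral_map hfm hΦi.aestronglyMeasurable).symm
  have hs : ∀ k : A, Integrable (c.successProb A k k.2) (gaussianMatrix K L) := fun k =>
    (c.integral_successProb A hM k).1
  rw [← integral_finsetSum _ fun k _ => hs k, ← integral_const_mul]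
  have h2 := integral_mono (((integrable_finsetSum T fun k _ => hs k)).const_mul a)
    ((hΦi'.const_mul n).add (integrable_const (t * Real.log (1 + (Real.exp a - 1) / M))))
    fun H => c.fano_successProb A hM hP ha T e H
  refine h2.trans_eq ?_
  simp only [Pi.add_apply]
  rw [integral_add (hΦi'.const_mul n) (integrable_const _), integral_const_mul, hΦe]
  simp [Φ]

/-- Averaged meta-converse: some active user has error probability at most the average one. -/
lemma Code.meta_converse (c : Code K Ka M n L P) (A : Finset (Fin K)) (hM : 0 < M) (hP : 0 ≤ P)
    {ε : ℝ} (hc : c.pupe A ≤ ε) (hA : 0 < A.card) (γ : ℝ) :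
    1 - ε ≤ Real.exp γ / M + ((singleUserLaw L (n + 1)).real {ω | γ < densityTrue P ω} -
      Real.exp γ * (singleUserLaw L (n + 1)).real {ω | γ < densityAux P ω}) := by
  have hA' : (0 : ℝ) < A.card := by exact_mod_cast hA
  set q : A → ℝ := fun k => ∫ H, c.successProb A k k.2 H ∂(gaussianMatrix K L) with hq
  obtain ⟨k, hk⟩ : ∃ k : A, 1 - q k ≤ ε := by
    by_contra! hcon
    rw [c.pupe_eq A hM, one_div, inv_mul_le_iff₀ hA'] at hc
    have hne : (Finset.univ : Finset A).Nonempty := by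
      obtain ⟨k, hk⟩ := Finset.card_pos.mp hA
      exact ⟨⟨k, hk⟩, Finset.mem_univ _⟩
    have h1 := Finset.sum_lt_sum_of_nonempty hne fun k _ => hcon k
    simp only [Finset.sum_const, Finset.card_univ, Fintype.card_coe, nsmul_eq_mul] at h1
    exact absurd hc (not_le.mpr h1)
  have hrow : ∀ {S : Set ((Fin L → ℂ) × (Fin (n + 1) → ℂ))}, MeasurableSet S →
      Integrable (fun H : Fin K → Fin L → ℂ =>
        (gaussianVector (n + 1)).real (Prod.mk (H k) ⁻¹' S)) (gaussianMatrix K L) ∧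
      ∫ H, (gaussianVector (n + 1)).real (Prod.mk (H k) ⁻¹' S) ∂(gaussianMatrix K L) =
        (singleUserLaw L (n + 1)).real S := by
    intro S hS
    have hm : AEMeasurable (fun H : Fin K → Fin L → ℂ => H k) (gaussianMatrix K L) :=
      (measurable_pi_apply _).aemeasurable
    have hi : Integrable (fun h => (gaussianVector (n + 1)).real (Prod.mk h ⁻¹' S))
        (gaussianVector L) := Measure.integrable_measure_prodMk_left hS (measure_ne_top _ _)
    have hmap := gaussianMatrix_map_row (L := L) (k : Fin K)
    unfold singleUserLaw
    rw [measureReal_prod_eq_integral _ _ hS]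
    rw [← hmap] at hi ⊢
    exact ⟨hi.comp_aemeasurable hm, (integral_map hm hi.aestronglyMeasurable).symm⟩
  obtain ⟨i1, e1⟩ := hrow (measurableSet_lt (measurable_const (a := γ))
    (measurable_single_densityTrue P))
  obtain ⟨i2, e2⟩ := hrow (measurableSet_lt (measurable_const (a := γ))
    (measurable_single_densityAux P))
  have h1 : 1 - ε ≤ q k := by linarith
  refine h1.trans ?_
  rw [← e1, ← e2, ← integral_const_mul, ← integral_sub i1 (i2.const_mul _)]
  have h2 : Real.exp γ / M = ∫ _H : Fin K → Fin L → ℂ, Real.exp γ / M ∂(gaussianMatrix K L) := by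
    simp
  have i3 : Integrable (fun H : Fin K → Fin L → ℂ =>
      (gaussianVector (n + 1)).real (Prod.mk (H k) ⁻¹' {ω | γ < densityTrue P ω}) -
        Real.exp γ * (gaussianVector (n + 1)).real (Prod.mk (H k) ⁻¹' {ω | γ < densityAux P ω}))
      (gaussianMatrix K L) := i1.sub (i2.const_mul _)
  rw [h2, ← integral_add (integrable_const _) i3]
  exact integral_mono (c.integral_successProb A hM k).1 ((integrable_const _).add i3)
    fun H => c.meta_successProb A hM hP γ k H

end Converse

/-- An achievable power satisfies the Fano-type condition. -/
lemma fanoCondition_of_achievable {K M n L : ℕ} {J ε P : ℝ} {A : Finset (Fin K)}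
    (hA : 0 < A.card) (hJ : 0 < J) (hM : (M : ℝ) = (2 : ℝ) ^ J) (hε0 : 0 ≤ ε) (hε1 : ε ≤ 1)
    (hP : 0 ≤ P) (h : Achievable M n L ε A P) : FanoCondition A.card n L J ε P := by
  obtain ⟨c, hc⟩ := h
  have hM1 : (1 : ℝ) ≤ M := by rw [hM]; exact Real.one_le_rpow one_le_two hJ.le
  have hM0 : 0 < M := by exact_mod_cast one_pos.trans_le hM1
  have hA' : (0 : ℝ) < A.card := by exact_mod_cast hA
  have h2 : 0 < Real.log 2 := Real.log_pos one_lt_two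
  have hlogM : Real.log M = J * Real.log 2 := by rw [hM, Real.log_rpow two_pos]
  intro t ht
  have htK : t ≤ A.card := (Finset.mem_Icc.mp ht).2
  have hI : 0 ≤ (n : ℝ) * ∫ H, Real.log (1 + (P : ℂ) •
      ((Matrix.of H)ᴴ * Matrix.of H)).det.re ∂(gaussianMatrix t L) :=
    mul_nonneg (Nat.cast_nonneg n) (integral_nonneg fun H =>
      (log_det_gram_bounds hP one_pos (Matrix.of H)).1)
  have key := fano_of_tilted (κ := A.card) (t := t) (Nat.cast_nonneg t) (by exact_mod_cast htK)
    hM1 hε0 hε1 hI fun a ha => c.tilted_fano A hM0 hP hc hA htK ha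
  simp_rw [logDet_eq]
  rw [integral_div, h₂]
  rw [hlogM] at key
  rw [← mul_le_mul_iff_of_pos_right (mul_pos hA' h2)]
  refine (le_of_eq ?_).trans (key.trans_eq ?_)
  · field_simp
  · field_simp

/-- An achievable power satisfies the meta-converse condition. -/
lemma metaConverseCondition_of_achievable {K M n L : ℕ} {ε P : ℝ} {A : Finset (Fin K)}
    (hA : 0 < A.card) (hM : 0 < M) (hL : 1 ≤ L) (hP : 0 < P)
    (h : Achievable M n L ε A P) : MetaConverseCondition M n L ε P := by
  obtain ⟨c, hc⟩ := h
  intro γ hγ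
  have hM' : (0 : ℝ) < M := by exact_mod_cast hM
  have hprob : IsProbabilityMeasure (singleUserLaw L (n + 1)) := by
    unfold singleUserLaw; infer_instance
  have h1 := c.meta_converse A hM hP.le hc hA γ
  have h2 : (singleUserLaw L (n + 1)).real {ω | γ < densityTrue P ω} = 1 - ε := by
    have hm : MeasurableSet {ω : (Fin L → ℂ) × (Fin (n + 1) → ℂ) | densityTrue P ω ≤ γ} :=
      measurableSet_le (measurable_single_densityTrue P) measurable_const
    rw [← hγ, ← probReal_compl_eq_one_sub hm]
    congr 1
    ext ω
    simp
  have h3 : (singleUserLaw L (n + 1)).real {ω | γ ≤ densityAux P ω} ≤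
      (singleUserLaw L (n + 1)).real {ω | γ < densityAux P ω} := by
    have hsub : {ω : (Fin L → ℂ) × (Fin (n + 1) → ℂ) | γ ≤ densityAux P ω} ⊆
        {ω | γ < densityAux P ω} ∪ {ω | densityAux P ω = γ} := by
      intro ω hω
      rcases (show γ ≤ densityAux P ω from hω).lt_or_eq with h | h
      · exact Or.inl h
      · exact Or.inr h.symm
    refine (measureReal_mono hsub).trans ((measureReal_union_le _ _).trans ?_)
    rw [measureReal_def (s := {ω | densityAux P ω = γ}), singleUserLaw_densityAux_eq_zero hP hL γ]
    simp
  rw [h2] at h1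
  have h4 : Real.exp γ * (singleUserLaw L (n + 1)).real {ω | γ < densityAux P ω} ≤
      Real.exp γ * (1 / M) := by
    rw [mul_one_div]; linarith
  have h5 := h3.trans (le_of_mul_le_mul_left h4 (Real.exp_pos γ))
  rw [le_div_iff₀ hM'] at h5
  rwa [mul_comm]

/-- A weaker condition on the power has a smaller infimal energy. -/
lemma infEnergy_anti {n : ℕ} {J : ℝ} {C D : ℝ → Prop} (h : ∀ P, 0 < P → C P → D P) :
    infEnergy n J D ≤ infEnergy n J C :=
  sInf_le_sInf fun _ ⟨P, hP, hC, he⟩ => ⟨P, hP, h P hP hC, he⟩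

end MassiveAccess

theorem mainTheorem5 (K Ka M n L : ℕ) (J ε : ℝ) (A : Finset (Fin K))
    (hKa : 1 ≤ Ka) (hA : A.card = Ka) (hn : 1 ≤ n) (hL : 1 ≤ L)
    (hJ : 0 < J) (hM : (M : ℝ) = (2 : ℝ) ^ J) (hε0 : 0 ≤ ε) (hε1 : ε ≤ 1) :
    -- every code meeting the error requirement satisfies all the bounds
    (∀ P : ℝ, 0 < P → MassiveAccess.Achievable M n L ε A P →
      MassiveAccess.FanoCondition Ka n L J ε P ∧
      MassiveAccess.LooseCondition Ka n L J ε P ∧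
      MassiveAccess.MetaConverseCondition M n L ε P) ∧
    -- the second condition is a loosened form of the first one
    (∀ P : ℝ, 0 < P → ∀ t ∈ Finset.Icc 1 Ka,
      Integrable (fun H : Fin t → Fin L → ℂ => MassiveAccess.logDet P H) (MassiveAccess.gaussianMatrix t L) ∧
      ∫ H, MassiveAccess.logDet P H ∂(MassiveAccess.gaussianMatrix t L) ≤
        min (L * Real.logb 2 (1 + P * t)) (t * Real.logb 2 (1 + P * L))) ∧
    (∀ P : ℝ, 0 < P → MassiveAccess.FanoCondition Ka n L J ε P →
      MassiveAccess.LooseCondition Ka n L J ε P) ∧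
    -- lower bounds on the minimum energy-per-bit
    MassiveAccess.infEnergy n J (MassiveAccess.FanoCondition Ka n L J ε) ≤
      MassiveAccess.minEnergyPerBit M n L J ε A ∧
    MassiveAccess.infEnergy n J (MassiveAccess.LooseCondition Ka n L J ε) ≤
      MassiveAccess.minEnergyPerBit M n L J ε A ∧
    MassiveAccess.infEnergy n J (fun P => MassiveAccess.FanoCondition Ka n L J ε P ∧
        MassiveAccess.MetaConverseCondition M n L ε P) ≤
      MassiveAccess.minEnergyPerBit M n L J ε A := by
  subst hA
  have hM0 : 0 < M := by
    have : (0 : ℝ) < M := by rw [hM]; positivity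
    exact_mod_cast this
  have hF : ∀ P : ℝ, 0 < P → MassiveAccess.Achievable M n L ε A P →
      MassiveAccess.FanoCondition A.card n L J ε P := fun P hP h =>
    MassiveAccess.fanoCondition_of_achievable hKa hJ hM hε0 hε1 hP.le h
  have hC : ∀ P : ℝ, 0 < P → MassiveAccess.Achievable M n L ε A P →
      MassiveAccess.MetaConverseCondition M n L ε P := fun P hP h =>
    MassiveAccess.metaConverseCondition_of_achievable hKa hM0 hL hP h
  exact ⟨fun P hP h => ⟨hF P hP h, (hF P hP h).loose hP.le, hC P hP h⟩,
    fun P hP t _ => MassiveAccess.integrable_logDet_and_le hP.le,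
    fun P hP h => h.loose hP.le,
    MassiveAccess.infEnergy_anti hF,
    MassiveAccess.infEnergy_anti fun P hP h => (hF P hP h).loose hP.le,
    MassiveAccess.infEnergy_anti fun P hP h => ⟨hF P hP h, hC P hP h⟩⟩
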